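/- For a compact connected metrizable space $X$, let $C(X)$ be the set of nonempty compact connected subsets of $X$ with the Vietoris topology (generated by the sets $\{K : K\subseteq U\}$ and $\{K : K\cap U\neq\emptyset\}$ for $U\subseteq X$ open). A chain on $X$ is a subset $\mathcal{C}\subseteq C(X)$ that is linearly ordered by inclusion and maximal with this property; every chain is itself compact and connected, and $\Phi(X)\subseteq C(C(X))$ denotes the space of all chains on $X$ with the subspace topology. The group $\mathrm{Homeo}(X)$ of self-homeomorphisms of $X$ acts on $\Phi(X)$ by $h\cdot\mathcal{C}=\{h[C] : C\in\mathcal{C}\}$. A chain $\mathcal{C}$ is generic if its orbit $\mathrm{Homeo}(X)\cdot\mathcal{C}$ is comeager in $\Phi(X)$. For a countable relational language $\mathcal{L}=\{R_i\}_{i\in I}$ with $R_i$ of arity $n_i$, let $\mathrm{Mod}(\mathcal{L})=\prod_{i\in I}2^{\mathbb{N}^{n_i}}$ (with the product topology) be the space of $\mathcal{L}$-structures with domain $\mathbb{N}$. **Theorem.** 1. The orbit equivalence relation of $\mathrm{Homeo}(S^1)\curvearrowright\Phi(S^1)$ is continuously reducible to that of $\mathrm{Homeo}([0,1])\curvearrowright\Phi([0,1])$: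 there is a continuous map $f\colon\Phi(S^1)\to\Phi([0,1])$ such that, for all $\mathcal{C},\mathcal{C}'\in\Phi(S^1)$, $\mathcal{C}'\in\mathrm{Homeo}(S^1)\cdot\mathcal{C}$ if and only if $f(\mathcal{C}')\in\mathrm{Homeo}([0,1])\cdot f(\mathcal{C})$. 2. Therefore chains on $S^1$ are classifiable by countable structures: there are a countable relational language $\mathcal{L}$ and a Borel map $\mathcal{M}\colon\Phi(S^1)\to\mathrm{Mod}(\mathcal{L})$ such that, for all $\mathcal{C},\mathcal{C}'\in\Phi(S^1)$, $\mathcal{C}'\in\mathrm{Homeo}(S^1)\cdot\mathcal{C}$ if and only if $\mathcal{M}(\mathcal{C})\cong\mathcal{M}(\mathcal{C}')$. 3. Moreover, there is a generic chain on $S^1$. -/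

import Mathlib

open Set Topology TopologicalSpace

universe u

/-- The hyperspace `C(X)` of subcontinua of `X`, i.e. of nonempty compact connected subsets of `X`,
ordered by inclusion and carrying the subspace topology of the Vietoris topology on
`NonemptyCompacts X`. -/
abbrev Subcontinua (X : Type u) [TopologicalSpace X] : Type u :=
  {K : NonemptyCompacts X // IsConnected (K : Set X)}

/-- The image of a subcontinuum under a continuous map. -/
def Subcontinua.map {X Y : Type u} [TopologicalSpace X] [TopologicalSpace Y] (f : X → Y)
    (hf : Continuous f) (K : Subcontinua X) : Subcontinua Y :=
  ⟨K.1.map f hf, by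
    rw [NonemptyCompacts.coe_map]
    exact K.2.image f hf.continuousOn⟩

theorem Subcontinua.coe_map {X Y : Type u} [TopologicalSpace X] [TopologicalSpace Y] (f : X → Y)
    (hf : Continuous f) (K : Subcontinua X) :
    ((Subcontinua.map f hf K).1 : Set Y) = f '' (K.1 : Set X) :=
  NonemptyCompacts.coe_map hf K.1

theorem Subcontinua.ext_coe {X : Type u} [TopologicalSpace X] {K L : Subcontinua X}
    (h : (K.1 : Set X) = (L.1 : Set X)) : K = L :=
  Subtype.ext (NonemptyCompacts.ext h)

theorem Subcontinua.continuous_map {X Y : Type u} [TopologicalSpace X] [TopologicalSpace Y]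
    (f : X → Y) (hf : Continuous f) : Continuous (Subcontinua.map f hf) :=
  (hf.nonemptyCompacts_map.comp continuous_subtype_val).subtype_mk _

theorem Subcontinua.map_mono {X Y : Type u} [TopologicalSpace X] [TopologicalSpace Y]
    (f : X → Y) (hf : Continuous f) {K L : Subcontinua X} (h : K ≤ L) :
    Subcontinua.map f hf K ≤ Subcontinua.map f hf L := by
  change ((Subcontinua.map f hf K).1 : Set Y) ⊆ (Subcontinua.map f hf L).1
  rw [Subcontinua.coe_map, Subcontinua.coe_map]
  exact Set.image_mono h

theorem Subcontinua.map_map {X : Type u} [TopologicalSpace X] (g h : X ≃ₜ X)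
    (K : Subcontinua X) :
    Subcontinua.map g g.continuous (Subcontinua.map h h.continuous K) =
      Subcontinua.map (g * h : X ≃ₜ X) (g * h : X ≃ₜ X).continuous K := by
  apply Subcontinua.ext_coe
  rw [Subcontinua.coe_map, Subcontinua.coe_map, Subcontinua.coe_map, Set.image_image]
  rfl

theorem Subcontinua.map_one {X : Type u} [TopologicalSpace X] (K : Subcontinua X) :
    Subcontinua.map (1 : X ≃ₜ X) (1 : X ≃ₜ X).continuous K = K := by
  apply Subcontinua.ext_coe
  rw [Subcontinua.coe_map]
  exact Set.image_id _

/-- The space `Φ(X)` of chains on `X`: the elements of `C(C(X))` that are, as sets of subcontinua,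
linearly ordered by inclusion and maximal with this property. -/
def ChainSpace (X : Type u) [TopologicalSpace X] : Type u :=
  {𝒞 : Subcontinua (Subcontinua X) // IsMaxChain (· ≤ ·) (𝒞.1 : Set (Subcontinua X))}

/-- `Φ(X)` carries the subspace topology of `C(C(X))`. -/
instance ChainSpace.instTopologicalSpace (X : Type u) [TopologicalSpace X] :
    TopologicalSpace (ChainSpace X) :=
  instTopologicalSpaceSubtype

theorem Subcontinua.isMaxChain_image {X : Type u} [TopologicalSpace X] (h : X ≃ₜ X)
    {s : Set (Subcontinua X)} (hs : IsMaxChain (· ≤ ·) s) :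
    IsMaxChain (· ≤ ·) (Subcontinua.map h h.continuous '' s) := by
  have inv1 : ∀ K : Subcontinua X, Subcontinua.map (h⁻¹ : X ≃ₜ X) (h⁻¹ : X ≃ₜ X).continuous
      (Subcontinua.map h h.continuous K) = K := fun K => by
    rw [Subcontinua.map_map]
    simp only [inv_mul_cancel]
    exact Subcontinua.map_one K
  have inv2 : ∀ K : Subcontinua X, Subcontinua.map h h.continuous
      (Subcontinua.map (h⁻¹ : X ≃ₜ X) (h⁻¹ : X ≃ₜ X).continuous K) = K := fun K => by
    rw [Subcontinua.map_map]
    simp only [mul_inv_cancel]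
    exact Subcontinua.map_one K
  refine ⟨hs.1.image_of_map_rel _ _ _ fun _ _ hxy => Subcontinua.map_mono _ _ hxy, ?_⟩
  intro t ht hst
  have key := hs.2 (t := Subcontinua.map (h⁻¹ : X ≃ₜ X) (h⁻¹ : X ≃ₜ X).continuous '' t)
    (ht.image_of_map_rel _ _ _ fun _ _ hxy => Subcontinua.map_mono _ _ hxy)
    (fun K hK => ⟨_, hst ⟨K, hK, rfl⟩, inv1 K⟩)
  rw [key, Set.image_image]
  simp only [inv2, Set.image_id']

/-- The action of `Homeo(X)` on `Φ(X)`: `h • 𝒞 = {h[C] : C ∈ 𝒞}`. -/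
instance ChainSpace.instMulAction (X : Type u) [TopologicalSpace X] :
    MulAction (X ≃ₜ X) (ChainSpace X) where
  smul h 𝒞 :=
    ⟨Subcontinua.map (Subcontinua.map h h.continuous)
        (Subcontinua.continuous_map h h.continuous) 𝒞.1, by
      rw [Subcontinua.coe_map]
      exact Subcontinua.isMaxChain_image h 𝒞.2⟩
  one_smul 𝒞 := by
    apply Subtype.ext
    apply Subcontinua.ext_coe
    refine (Subcontinua.coe_map _ _ _).trans ?_
    simp only [Subcontinua.map_one, Set.image_id']
  mul_smul g h 𝒞 := by
    apply Subtype.ext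
    apply Subcontinua.ext_coe
    refine (Subcontinua.coe_map _ _ _).trans ?_
    refine Eq.trans ?_ (Subcontinua.coe_map _ _ _).symm
    refine Eq.trans ?_ (congrArg _ (Subcontinua.coe_map _ _ _).symm)
    simp only [Set.image_image, Subcontinua.map_map]

theorem ChainSpace.coe_smul {X : Type u} [TopologicalSpace X] (h : X ≃ₜ X) (𝒞 : ChainSpace X) :
    ((h • 𝒞).1.1 : Set (Subcontinua X)) =
      Subcontinua.map h h.continuous '' (𝒞.1.1 : Set (Subcontinua X)) :=
  Subcontinua.coe_map _ _ _

/-- The orbit equivalence relation of `Homeo(X)` acting on `Φ(X)`. -/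
def ChainSpace.orbitRel (X : Type u) [TopologicalSpace X] : Setoid (ChainSpace X) :=
  MulAction.orbitRel (X ≃ₜ X) (ChainSpace X)

/-- A chain is generic if its orbit under `Homeo(X)` is comeager in `Φ(X)`. -/
def ChainSpace.IsGeneric {X : Type u} [TopologicalSpace X] (𝒞 : ChainSpace X) : Prop :=
  MulAction.orbit (X ≃ₜ X) 𝒞 ∈ residual (ChainSpace X)

/-- `r` is continuously reducible to `s`. -/
def ContinuouslyReducible {Y Z : Type u} [TopologicalSpace Y] [TopologicalSpace Z]
    (r : Setoid Y) (s : Setoid Z) : Prop :=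
  ∃ f : Y → Z, Continuous f ∧ ∀ y y' : Y, r y y' ↔ s (f y) (f y')

/-- The space `Mod(L)` of `L`-structures with domain `ℕ`, for a relational language `L`: the product
over the relation symbols `R` of `L` of the spaces `2 ^ (ℕ ^ (arity of R))`. -/
abbrev ModSpace (L : FirstOrder.Language.{0, 0}) : Type :=
  (R : Σ n : ℕ, L.Relations n) → (Fin R.1 → ℕ) → Bool

/-- The `L`-structure on `ℕ` coded by a point of `Mod(L)`. -/
@[reducible]
def ModSpace.toStructure {L : FirstOrder.Language.{0, 0}} [L.IsRelational] (M : ModSpace L) :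
    L.Structure ℕ where
  funMap := fun f => isEmptyElim f
  RelMap := fun {n} R v => M ⟨n, R⟩ v = true

/-- Isomorphism of the coded structures. -/
def ModSpace.Iso {L : FirstOrder.Language.{0, 0}} [L.IsRelational] (M N : ModSpace L) : Prop :=
  Nonempty (@FirstOrder.Language.Equiv L ℕ ℕ M.toStructure N.toStructure)

/-- An equivalence relation on a topological space `Y` is classifiable by countable structures if
there is a Borel map from `Y` to `Mod(L)`, for some countable relational language `L`, that reduces
the relation to isomorphism of structures. -/
def ClassifiableByCountableStructures {Y : Type u} [TopologicalSpace Y] (r : Setoid Y) : Prop :=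
  ∃ (L : FirstOrder.Language.{0, 0}) (_ : L.IsRelational) (_ : Countable (Σ n : ℕ, L.Relations n))
    (f : Y → ModSpace L),
    @Measurable Y (ModSpace L) (borel Y) (borel (ModSpace L)) f ∧
      ∀ y y' : Y, r y y' ↔ (f y).Iso (f y')

/-!
A chain on `[0,1]` contains exactly one interval of each length `u ∈ [0,1]`, and is therefore encoded
by the `1`-Lipschitz function `m` sending `u` to the sum of the end points of this interval; such
functions with `m 1 = 1` are called profiles. The only substantial point here is that a maximal chain
contains intervals of all lengths (`Profile.exists_range_arc_eq`).

A chain on the circle has a base point, the only point in the closure of the complement of each of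
its proper members. Cutting the circle at the base point turns the chain into one on `[0,1]`. Thus
`(z, m) ↦` (the chain with base point `z` and profile `m`) is a continuous bijection from
`Circle × Profile`, which is compact, onto the Hausdorff space of chains on the circle, hence a
homeomorphism (`Profile.circleChainHomeomorph`). A homeomorphism of the circle matching two chains
matches their base points; after rotations it fixes `1` and lifts to `[0,1]`, and conversely all
homeomorphisms of `[0,1]` descend to the circle. So forgetting the base point is a continuous
reduction to the action on chains on `[0,1]` (`Profile.orbitRel_circleChain_iff`).

Two chains on `[0,1]` are in the same orbit iff, up to exchanging left and right, some increasing
reparametrization of the lengths matches their plateaus, the intervals of lengths on which one of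
the end points is constant (`Profile.orbitRel_intervalChain_iff`). The interiors of the
plateaus, together with the maximal open intervals meeting no nondegenerate plateau, are countably
many open cells with dense union. Up to
isomorphism they are recovered from the countable structure consisting of those points of a fixed
countable dense set of lengths that lie in cells, with their order and the relation of spanning
plateaus of the same end point: an isomorphism of two such structures extends by density to a
reparametrization, and conversely Cantor's theorem, applied in each cell, turns a reparametrization
into an isomorphism. Infinitely many isolated points are added to keep the domain equal to `ℕ`
(`Profile.iso_code_iff_samePlateaus`).

Finally, all profiles without plateaus give chains in a single orbit, and having no plateau is a
countable intersection of open conditions, which are dense since mixing any profile with a constant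
one destroys all plateaus (`Profile.isGeneric_circleChain_const`).
-/

noncomputable section

/-! ### Maximal chains of subcontinua -/

namespace Subcontinua

theorem le_iff {X : Type u} [TopologicalSpace X] {K L : Subcontinua X} :
    K ≤ L ↔ (K.1 : Set X) ⊆ (L.1 : Set X) := Iff.rfl

theorem continuous_map_family {A X Y : Type u} [TopologicalSpace A] [TopologicalSpace X]
    [TopologicalSpace Y] {K : A → Subcontinua X} {g : A → X → Y} (hK : Continuous K)
    (hg : Continuous g.uncurry) :
    Continuous fun a => Subcontinua.map (g a) (hg.comp (Continuous.prodMk_right a)) (K a) :=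
  (Continuous.nonemptyCompacts_map' (continuous_subtype_val.comp hK) hg).subtype_mk _

theorem exists_eq_Icc (K : Subcontinua unitInterval) :
    ∃ a b : unitInterval, a ≤ b ∧ (K.1 : Set unitInterval) = Icc a b := by
  have h := eq_Icc_of_connected_compact K.2 K.1.isCompact
  refine ⟨_, _, ?_, h⟩
  rw [← nonempty_Icc, ← h]
  exact K.2.nonempty

/-- The whole unit interval, as a subcontinuum of itself. -/
def unit : Subcontinua unitInterval :=
  ⟨⊤, by rw [NonemptyCompacts.coe_top]; exact isConnected_univ⟩

theorem coe_unit : (unit.1 : Set unitInterval) = univ := NonemptyCompacts.coe_top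

end Subcontinua

theorem isMaxChain_of_forall_comparable {α : Type*} [Preorder α] {s : Set α}
    (hs : IsChain (· ≤ ·) s) (h : ∀ K, (∀ J ∈ s, J ≤ K ∨ K ≤ J) → K ∈ s) :
    IsMaxChain (· ≤ ·) s := by
  refine ⟨hs, fun t ht hst => hst.antisymm fun K hK => h K fun J hJ => ?_⟩
  exact ht.total (hst hJ) hK

theorem IsMaxChain.mem_of_forall_comparable {α : Type*} [Preorder α] {s : Set α}
    (hs : IsMaxChain (· ≤ ·) s) {K : α} (h : ∀ J ∈ s, K ≤ J ∨ J ≤ K) : K ∈ s := by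
  have := hs.2 (hs.1.insert fun J hJ _ => h J hJ) (subset_insert K s)
  rw [this]
  exact mem_insert _ _

/-! ### Profiles and chains on the unit interval -/

/-- A profile is a `1`-Lipschitz function `m : [0,1] → ℝ` with `m 1 = 1`; it encodes the chain of
the intervals of length `u` with midpoint `m u / 2`, for `u ∈ [0,1]`. The space of profiles carries
the topology of pointwise convergence. -/
def Profile : Type := {m : unitInterval → ℝ // LipschitzWith 1 m ∧ m 1 = 1}

namespace Profile

instance : TopologicalSpace Profile := instTopologicalSpaceSubtype

instance : CoeFun Profile fun _ => unitInterval → ℝ := ⟨Subtype.val⟩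

theorem abs_sub_le (m : Profile) (u v : unitInterval) : |m u - m v| ≤ |(u : ℝ) - v| := by
  simpa [Real.dist_eq, Subtype.dist_eq] using m.2.1.dist_le_mul u v

theorem sub_le (m : Profile) {u v : unitInterval} (h : u ≤ v) : m u - m v ≤ v - u := by
  have h1 := (abs_le.1 (m.abs_sub_le u v)).2
  have h2 : (u : ℝ) ≤ v := h
  rwa [abs_of_nonpos (by linarith), neg_sub] at h1

theorem sub_le' (m : Profile) {u v : unitInterval} (h : u ≤ v) : m v - m u ≤ v - u := by
  have h1 := (abs_le.1 (m.abs_sub_le v u)).2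
  have h2 : (u : ℝ) ≤ v := h
  rwa [abs_of_nonneg (by linarith)] at h1

theorem le_apply (m : Profile) (u : unitInterval) : (u : ℝ) ≤ m u := by
  have h := m.sub_le' (u := u) (v := 1) u.2.2
  rw [m.2.2] at h
  simp only [Icc.coe_one] at h
  linarith

theorem apply_le (m : Profile) (u : unitInterval) : m u ≤ 2 - u := by
  have h := m.sub_le (u := u) (v := 1) u.2.2
  rw [m.2.2] at h
  simp only [Icc.coe_one] at h
  linarith

instance : CompactSpace Profile := by
  refine isCompact_iff_compactSpace.1 ?_
  refine (isCompact_univ_pi fun _ : unitInterval =>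
    isCompact_Icc (a := (0 : ℝ)) (b := 2)).of_isClosed_subset ?_ fun m hm u _ => ?_
  · have : {m : unitInterval → ℝ | LipschitzWith 1 m ∧ m 1 = 1} =
        (⋂ (u : unitInterval) (v : unitInterval),
          {m : unitInterval → ℝ | dist (m u) (m v) ≤ dist u v}) ∩ {m | m 1 = 1} := by
      ext m
      simp only [mem_ofPred_eq, lipschitzWith_iff_dist_le_mul, NNReal.coe_one, one_mul, mem_inter_iff,
        mem_iInter]
    change IsClosed {m : unitInterval → ℝ | LipschitzWith 1 m ∧ m 1 = 1}
    rw [this]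
    refine (isClosed_iInter fun u => isClosed_iInter fun v => ?_).inter ?_
    · exact isClosed_le (by fun_prop) continuous_const
    · exact isClosed_eq (by fun_prop) continuous_const
  · exact ⟨u.2.1.trans (le_apply ⟨m, hm⟩ u),
      (apply_le ⟨m, hm⟩ u).trans (by linarith [u.2.1])⟩

theorem continuous_eval : Continuous fun p : Profile × unitInterval => p.1 p.2 :=
  continuous_prod_of_continuous_lipschitzWith' _ 1 (fun m => m.2.1)
    fun u => (continuous_apply u).comp continuous_subtype_val

theorem continuous_coe (m : Profile) : Continuous m := m.2.1.continuous

theorem continuous_apply (u : unitInterval) : Continuous fun m : Profile => m u :=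
  (_root_.continuous_apply u).comp continuous_subtype_val

/-- The left end point of the interval of length `u` of the chain with profile `m`. -/
def left (m : Profile) (u : unitInterval) : unitInterval :=
  ⟨(m u - u) / 2, by linarith [m.le_apply u], by linarith [m.apply_le u, u.2.1]⟩

/-- The right end point of the interval of length `u` of the chain with profile `m`. -/
def right (m : Profile) (u : unitInterval) : unitInterval :=
  ⟨(m u + u) / 2, by linarith [m.le_apply u, u.2.1], by linarith [m.apply_le u]⟩

theorem coe_left (m : Profile) (u : unitInterval) : (m.left u : ℝ) = (m u - u) / 2 := rfl

theorem coe_right (m : Profile) (u : unitInterval) : (m.right u : ℝ) = (m u + u) / 2 := rfl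

theorem right_sub_left (m : Profile) (u : unitInterval) : (m.right u : ℝ) - m.left u = u := by
  rw [coe_left, coe_right]; ring

theorem left_add_right (m : Profile) (u : unitInterval) : (m.left u : ℝ) + m.right u = m u := by
  rw [coe_left, coe_right]; ring

theorem continuous_left (m : Profile) : Continuous m.left := by
  have := m.continuous_coe
  exact Continuous.subtype_mk (by fun_prop) _

theorem continuous_right (m : Profile) : Continuous m.right := by
  have := m.continuous_coe
  exact Continuous.subtype_mk (by fun_prop) _

theorem left_anti (m : Profile) : Antitone m.left := fun u v h => by
  rw [← Subtype.coe_le_coe, coe_left, coe_left]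
  linarith [m.sub_le' h]

theorem right_mono (m : Profile) : Monotone m.right := fun u v h => by
  rw [← Subtype.coe_le_coe, coe_right, coe_right]
  linarith [m.sub_le h]

theorem left_le_right (m : Profile) (u : unitInterval) : m.left u ≤ m.right u := by
  rw [← Subtype.coe_le_coe]
  linarith [m.right_sub_left u, u.2.1]

theorem left_zero (m : Profile) : m.left 0 = m.right 0 := by
  apply Subtype.ext
  simp [coe_left, coe_right]

theorem left_one (m : Profile) : m.left 1 = 0 := by
  apply Subtype.ext
  simp [coe_left, m.2.2]

theorem right_one (m : Profile) : m.right 1 = 1 := by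
  apply Subtype.ext
  simp [coe_right, m.2.2]

theorem left_le_right' (m : Profile) (u v : unitInterval) : m.left u ≤ m.right v :=
  (m.left_anti u.2.1).trans (m.left_zero.le.trans (m.right_mono v.2.1))

theorem ext {m m' : Profile} (h : ∀ u, m u = m' u) : m = m' := Subtype.ext (funext h)

/-- The affine parametrization of the interval of length `u` of the chain with profile `m`. -/
def param (m : Profile) (u t : unitInterval) : unitInterval :=
  ⟨(m u - u) / 2 + t * u, add_nonneg (m.left u).2.1 (mul_nonneg t.2.1 u.2.1), by
    have h1 : (t : ℝ) * u ≤ u := mul_le_of_le_one_left u.2.1 t.2.2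
    have h2 := (m.right u).2.2
    rw [coe_right] at h2
    linarith⟩

theorem continuous_param :
    Continuous fun p : (Profile × unitInterval) × unitInterval => p.1.1.param p.1.2 p.2 := by
  have : Continuous fun p : (Profile × unitInterval) × unitInterval => p.1.1 p.1.2 :=
    continuous_eval.comp continuous_fst
  exact Continuous.subtype_mk (by fun_prop) _

/-- The interval of length `u` of the chain with profile `m`. -/
def arc (m : Profile) (u : unitInterval) : Subcontinua unitInterval :=
  Subcontinua.map (m.param u) (continuous_param.comp (Continuous.prodMk_right (m, u)))
    Subcontinua.unit

theorem continuous_arc : Continuous fun p : Profile × unitInterval => p.1.arc p.2 :=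
  Subcontinua.continuous_map_family (g := fun p : Profile × unitInterval => p.1.param p.2)
    continuous_const continuous_param

theorem coe_arc (m : Profile) (u : unitInterval) :
    ((m.arc u).1 : Set unitInterval) = Icc (m.left u) (m.right u) := by
  rw [arc, Subcontinua.coe_map, Subcontinua.coe_unit, image_univ]
  ext x
  rw [mem_Icc, ← Subtype.coe_le_coe, ← Subtype.coe_le_coe, coe_left, coe_right]
  constructor
  · rintro ⟨t, rfl⟩
    have h1 : (t : ℝ) * u ≤ u := mul_le_of_le_one_left u.2.1 t.2.2
    have h0 : 0 ≤ (t : ℝ) * u := mul_nonneg t.2.1 u.2.1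
    simp only [param]
    constructor <;> linarith
  · rintro ⟨h1, h2⟩
    rcases u.2.1.eq_or_lt with h0 | h0
    · refine ⟨0, Subtype.ext ?_⟩
      simp only [param, ← h0, Icc.coe_zero]
      rw [← h0] at h1 h2
      linarith
    · refine ⟨⟨((x : ℝ) - (m u - u) / 2) / u, div_nonneg (by linarith) h0.le,
        (div_le_one h0).2 (by linarith)⟩, Subtype.ext ?_⟩
      simp only [param]
      field_simp
      ring

theorem arc_le_arc_iff {m : Profile} {u v : unitInterval} : m.arc u ≤ m.arc v ↔ u ≤ v := by
  rw [Subcontinua.le_iff, coe_arc, coe_arc, Icc_subset_Icc_iff (m.left_le_right u)]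
  constructor
  · rintro ⟨h1, h2⟩
    rw [← Subtype.coe_le_coe] at *
    linarith [m.right_sub_left u, m.right_sub_left v]
  · exact fun h => ⟨m.left_anti h, m.right_mono h⟩

theorem eq_arc_iff {m : Profile} {u : unitInterval} {K : Subcontinua unitInterval} :
    K = m.arc u ↔ (K.1 : Set unitInterval) = Icc (m.left u) (m.right u) :=
  ⟨fun h => by rw [h, coe_arc], fun h => Subcontinua.ext_coe (by rw [h, coe_arc])⟩

theorem isChain_range_arc (m : Profile) : IsChain (· ≤ ·) (range m.arc) := by
  rintro _ ⟨u, rfl⟩ _ ⟨v, rfl⟩ _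
  simp only [arc_le_arc_iff]
  exact le_total u v

/-- An interval comparable with all intervals of the chain is comparable with the one of the same
length, hence equal to it. -/
theorem isMaxChain_range_arc (m : Profile) : IsMaxChain (· ≤ ·) (range m.arc) := by
  refine isMaxChain_of_forall_comparable m.isChain_range_arc fun K hK => ?_
  obtain ⟨a, b, hab, hKab⟩ := K.exists_eq_Icc
  have hab' : (a : ℝ) ≤ b := hab
  let u : unitInterval := ⟨b - a, by linarith, by linarith [a.2.1, b.2.2]⟩
  have hu : (m.right u : ℝ) - m.left u = b - a := m.right_sub_left u
  refine ⟨u, Eq.symm (eq_arc_iff.2 ?_)⟩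
  have key : m.left u = a ∧ m.right u = b := by
    rcases hK _ ⟨u, rfl⟩ with h | h <;>
    · rw [Subcontinua.le_iff, coe_arc, hKab,
        Icc_subset_Icc_iff (by first | exact hab | exact m.left_le_right u)] at h
      have h1 : ((_ : unitInterval) : ℝ) ≤ _ := h.1
      have h2 : ((_ : unitInterval) : ℝ) ≤ _ := h.2
      exact ⟨Subtype.ext (by linarith), Subtype.ext (by linarith)⟩
  rw [hKab, key.1, key.2]

theorem arc_one (m : Profile) : ((m.arc 1).1 : Set unitInterval) = univ := by
  rw [coe_arc, left_one, right_one]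
  exact Icc_bot_top

/-- The interiors of the proper intervals of the chain cover `(0, 1)`. -/
theorem mem_arc_of_ne_one (m : Profile) {x : unitInterval} (h0 : 0 < x) (h1 : x < 1) :
    ∃ u : unitInterval, u < 1 ∧ m.left u < x ∧ x < m.right u := by
  have h0' : (0 : ℝ) < x := h0
  have h1' : (x : ℝ) < 1 := h1
  obtain ⟨c, hc, hc1⟩ := exists_between (max_lt h1' (show (1 : ℝ) - x < 1 by linarith))
  obtain ⟨hcx, hcx'⟩ := max_lt_iff.1 hc
  let u : unitInterval := ⟨c, by linarith, hc1.le⟩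
  have e1 := m.apply_le u
  have e2 := m.le_apply u
  have hu : (u : ℝ) = c := rfl
  refine ⟨u, hc1, ?_, ?_⟩
  · rw [← Subtype.coe_lt_coe, coe_left]; linarith
  · rw [← Subtype.coe_lt_coe, coe_right]; linarith

/-- The chain with profile `m`, as a subcontinuum of the hyperspace. -/
def subcontinuum (m : Profile) : Subcontinua (Subcontinua unitInterval) :=
  Subcontinua.map m.arc (continuous_arc.comp (Continuous.prodMk_right m)) Subcontinua.unit

theorem coe_subcontinuum (m : Profile) :
    (m.subcontinuum.1 : Set (Subcontinua unitInterval)) = range m.arc := by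
  rw [subcontinuum, Subcontinua.coe_map, Subcontinua.coe_unit, image_univ]

theorem continuous_subcontinuum : Continuous subcontinuum :=
  Subcontinua.continuous_map_family (g := fun m : Profile => m.arc) continuous_const
    continuous_arc

/-- The chain on `[0,1]` with profile `m`. -/
def intervalChain (m : Profile) : ChainSpace unitInterval :=
  ⟨m.subcontinuum, by rw [coe_subcontinuum]; exact m.isMaxChain_range_arc⟩

theorem coe_intervalChain (m : Profile) :
    (m.intervalChain.1.1 : Set (Subcontinua unitInterval)) = range m.arc := m.coe_subcontinuum

theorem continuous_intervalChain : Continuous intervalChain :=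
  continuous_subcontinuum.subtype_mk _

/-- Every maximal chain of subintervals contains an interval of each length: for `u ∈ [0,1]`, an
interval of length `u` containing all members of length at most `u` and contained in all members of
length at least `u` exists, and it belongs to the chain by maximality. -/
theorem exists_range_arc_eq {S : Set (Subcontinua unitInterval)} (hS : IsMaxChain (· ≤ ·) S) :
    ∃ m : Profile, range m.arc = S := by
  choose lo hi hle hcoe using Subcontinua.exists_eq_Icc
  have le_iff : ∀ {K L : Subcontinua unitInterval},
      K ≤ L ↔ (lo L : ℝ) ≤ lo K ∧ (hi K : ℝ) ≤ hi L := fun {K L} => by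
    rw [Subcontinua.le_iff, hcoe K, hcoe L, Icc_subset_Icc_iff (hle K)]
    rfl
  have hle' : ∀ K, (lo K : ℝ) ≤ hi K := hle
  have tot : ∀ {K L}, K ∈ S → L ∈ S → K ≤ L ∨ L ≤ K := fun hK hL => hS.1.total hK hL
  have hunit : Subcontinua.unit ∈ S := hS.mem_of_forall_comparable fun J _ => Or.inr <| by
    rw [Subcontinua.le_iff, Subcontinua.coe_unit]
    exact subset_univ _
  have hlu : (lo Subcontinua.unit : ℝ) = 0 ∧ (hi Subcontinua.unit : ℝ) = 1 := by
    have h := hcoe Subcontinua.unit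
    rw [Subcontinua.coe_unit] at h
    have h0 : (0 : unitInterval) ∈ Icc _ _ := h ▸ mem_univ _
    have h1 : (1 : unitInterval) ∈ Icc _ _ := h ▸ mem_univ _
    have h0' : (lo Subcontinua.unit : ℝ) ≤ 0 := h0.1
    have h1' : (1 : ℝ) ≤ hi Subcontinua.unit := h1.2
    exact ⟨le_antisymm h0' (lo _).2.1, le_antisymm (hi _).2.2 h1'⟩
  have key : ∀ u : unitInterval, ∃ K ∈ S, (hi K : ℝ) - lo K = u := by
    intro u
    let A : Set (Subcontinua unitInterval) := {K ∈ S | (hi K : ℝ) - lo K ≤ u}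
    let B : Set (Subcontinua unitInterval) := {K ∈ S | (u : ℝ) ≤ hi K - lo K}
    have hAB : ∀ K ∈ A, ∀ L ∈ B, (lo L : ℝ) ≤ lo K ∧ (hi K : ℝ) ≤ hi L := by
      rintro K ⟨hK, hKu⟩ L ⟨hL, hLu⟩
      rcases tot hK hL with h | h
      · exact le_iff.1 h
      · have h := le_iff.1 h
        constructor <;> linarith
    have hBu : Subcontinua.unit ∈ B := ⟨hunit, by rw [hlu.1, hlu.2]; linarith [u.2.2]⟩
    obtain ⟨c, hc1, hc2⟩ := exists_between_of_forall_le
      (s := (fun K => (lo K : ℝ)) '' B ∪ (fun K => (hi K : ℝ) - u) '' A)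
      (t := (fun K => (lo K : ℝ)) '' A ∪ (fun K => (hi K : ℝ) - u) '' B)
      ⟨_, Or.inl ⟨_, hBu, rfl⟩⟩ ⟨_, Or.inr ⟨_, hBu, rfl⟩⟩ (by
        rintro _ (⟨K, hK, rfl⟩ | ⟨K, hK, rfl⟩) _ (⟨L, hL, rfl⟩ | ⟨L, hL, rfl⟩) <;> dsimp only
        · exact (hAB L hL K hK).1
        · have h1 := hK.2; have h2 := hL.2
          rcases tot hK.1 hL.1 with h | h
          · have h := le_iff.1 h; linarith
          · have h := le_iff.1 h; linarith
        · have h1 := hK.2; have h2 := hL.2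
          rcases tot hK.1 hL.1 with h | h
          · have h := le_iff.1 h; linarith
          · have h := le_iff.1 h; linarith
        · linarith [(hAB K hK L hL).2])
    have hB : ∀ K ∈ B, (lo K : ℝ) ≤ c ∧ c + u ≤ hi K := fun K hK =>
      ⟨hc1 (Or.inl ⟨K, hK, rfl⟩), by linarith [hc2 (Or.inr ⟨K, hK, rfl⟩)]⟩
    have hA : ∀ K ∈ A, c ≤ lo K ∧ (hi K : ℝ) ≤ c + u := fun K hK =>
      ⟨hc2 (Or.inl ⟨K, hK, rfl⟩), by linarith [hc1 (Or.inr ⟨K, hK, rfl⟩)]⟩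
    have hcu := hB _ hBu
    rw [hlu.1, hlu.2] at hcu
    let a : unitInterval := ⟨c, hcu.1, by linarith [u.2.1]⟩
    let b : unitInterval := ⟨c + u, by linarith [u.2.1], hcu.2⟩
    have hab : a ≤ b := show c ≤ c + u by linarith [u.2.1]
    let K : Subcontinua unitInterval :=
      ⟨⟨⟨Icc a b, isCompact_Icc⟩, nonempty_Icc.2 hab⟩, isConnected_Icc hab⟩
    have hK : Icc (lo K) (hi K) = Icc a b := (hcoe K).symm
    have hKa : (lo K : ℝ) = c ∧ (hi K : ℝ) = c + u := by
      have h1 := (Icc_subset_Icc_iff (hle K)).1 hK.subset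
      have h2 := (Icc_subset_Icc_iff hab).1 hK.symm.subset
      have e1 : lo K = a := le_antisymm h2.1 h1.1
      have e2 : hi K = b := le_antisymm h1.2 h2.2
      rw [e1, e2]
      exact ⟨rfl, rfl⟩
    refine ⟨K, hS.mem_of_forall_comparable fun J hJ => ?_, by rw [hKa.1, hKa.2]; ring⟩
    rw [le_iff, le_iff, hKa.1, hKa.2]
    rcases le_total ((hi J : ℝ) - lo J) u with h | h
    · exact Or.inr (hA J ⟨hJ, h⟩)
    · exact Or.inl (hB J ⟨hJ, h⟩)
  choose k hkS hk using key
  let m : unitInterval → ℝ := fun u => lo (k u) + hi (k u)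
  have hm : ∀ u v : unitInterval, (u : ℝ) ≤ v → |m u - m v| ≤ v - u := by
    intro u v huv
    have h1 := hk u
    have h2 := hk v
    rw [abs_le]
    rcases tot (hkS u) (hkS v) with h | h <;>
    · have h := le_iff.1 h
      simp only [m]
      constructor <;> linarith
  let M : Profile := ⟨m, LipschitzWith.of_dist_le_mul fun u v => by
      rw [NNReal.coe_one, one_mul, Subtype.dist_eq, Real.dist_eq, Real.dist_eq]
      rcases le_total (u : ℝ) v with h | h
      · rw [abs_of_nonpos (by linarith : (u : ℝ) - v ≤ 0)]
        linarith [hm u v h]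
      · rw [abs_of_nonneg (by linarith : 0 ≤ (u : ℝ) - v), abs_sub_comm]
        exact hm v u h, by
      have h := hk 1
      simp only [Icc.coe_one] at h
      have h1 := (lo (k 1)).2.1
      have h2 := (hi (k 1)).2.2
      simp only [m]
      linarith⟩
  refine ⟨M, M.isMaxChain_range_arc.2 hS.1 ?_⟩
  rintro _ ⟨u, rfl⟩
  have : k u = M.arc u := eq_arc_iff.2 <| by
    rw [hcoe]
    have h := hk u
    congr 1 <;> apply Subtype.ext
    · rw [coe_left]; simp only [M, m]; linarith
    · rw [coe_right]; simp only [M, m]; linarith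
  rw [← this]
  exact hkS u

theorem arc_eq_arc {m m' : Profile} {u v : unitInterval} (h : m.arc u = m'.arc v) :
    u = v ∧ m u = m' v := by
  have h := eq_arc_iff.1 h
  rw [coe_arc] at h
  have h1 := (Icc_subset_Icc_iff (m.left_le_right u)).1 h.subset
  have h2 := (Icc_subset_Icc_iff (m'.left_le_right v)).1 h.symm.subset
  have e1 : m.left u = m'.left v := le_antisymm h2.1 h1.1
  have e2 : m.right u = m'.right v := le_antisymm h1.2 h2.2
  refine ⟨Subtype.ext ?_, ?_⟩
  · rw [← m.right_sub_left u, ← m'.right_sub_left v, e1, e2]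
  · rw [← m.left_add_right u, ← m'.left_add_right v, e1, e2]

theorem range_arc_injective {m m' : Profile} (h : range m.arc = range m'.arc) : m = m' := by
  refine Profile.ext fun u => ?_
  obtain ⟨v, hv⟩ : m.arc u ∈ range m'.arc := h ▸ mem_range_self u
  obtain ⟨rfl, h2⟩ := arc_eq_arc hv
  exact h2.symm

end Profile

/-! ### Order isomorphisms of the unit interval -/

/-- A relation with full domain and full range that preserves and reflects the strict order is the
graph of an order isomorphism. -/
theorem exists_orderIso_of_rel {α β : Type*} [LinearOrder α] [LinearOrder β] (G : α → β → Prop)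
    (h₁ : ∀ x, ∃ y, G x y) (h₂ : ∀ y, ∃ x, G x y)
    (hlt : ∀ x y x' y', G x y → G x' y' → (x < x' ↔ y < y')) :
    ∃ g : α ≃o β, ∀ x y, G x y → g x = y := by
  choose f hf using h₁
  have huniq : ∀ x y, G x y → f x = y := fun x y h => by
    have a := hlt _ _ _ _ (hf x) h
    have b := hlt _ _ _ _ h (hf x)
    exact le_antisymm (not_lt.1 fun hc => lt_irrefl _ (b.2 hc))
      (not_lt.1 fun hc => lt_irrefl _ (a.2 hc))
  have hmono : StrictMono f := fun x x' h => (hlt _ _ _ _ (hf x) (hf x')).1 h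
  have hsurj : Function.Surjective f := fun y => by
    obtain ⟨x, hx⟩ := h₂ y
    exact ⟨x, huniq x y hx⟩
  exact ⟨hmono.orderIsoOfSurjective f hsurj, huniq⟩

theorem Dense.exists_mem_between₂ {D : Set unitInterval} (hD : Dense D) {x y : unitInterval}
    (h : x < y) : ∃ d ∈ D, ∃ d' ∈ D, x < d ∧ d < d' ∧ d' < y := by
  obtain ⟨d, hd, h1, h2⟩ := hD.exists_between h
  obtain ⟨d', hd', h3, h4⟩ := hD.exists_between h2
  exact ⟨d, hd, d', hd', h1, h3, h4⟩

/-- An order isomorphism between dense subsets of the unit interval extends to the unit interval: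
the value at `x` is the unique point separating the images of the points below and above `x`. -/
theorem exists_orderIso_extending {D D' : Set unitInterval} (hD : Dense D) (hD' : Dense D')
    {ψ : unitInterval → unitInterval} (hψ : StrictMonoOn ψ D) (himg : ψ '' D = D') :
    ∃ φ : unitInterval ≃o unitInterval, EqOn φ ψ D := by
  have hD'ψ : ∀ {x y : unitInterval}, x < y →
      ∃ d ∈ D, ∃ d' ∈ D, d < d' ∧ x < ψ d ∧ ψ d' < y := fun h => by
    obtain ⟨a, ha, b, hb, h1, h2, h3⟩ := hD'.exists_mem_between₂ h
    rw [← himg] at ha hb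
    obtain ⟨d, hd, rfl⟩ := ha
    obtain ⟨d', hd', rfl⟩ := hb
    exact ⟨d, hd, d', hd', (hψ.lt_iff_lt hd hd').1 h2, h1, h3⟩
  let G : unitInterval → unitInterval → Prop :=
    fun x y => ∀ d ∈ D, (d ≤ x → ψ d ≤ y) ∧ (x ≤ d → y ≤ ψ d)
  suffices h : ∃ φ : unitInterval ≃o unitInterval, ∀ x y, G x y → φ x = y by
    obtain ⟨φ, hφ⟩ := h
    exact ⟨φ, fun d hd => hφ _ _ fun d' hd' =>
      ⟨fun h => hψ.monotoneOn hd' hd h, fun h => hψ.monotoneOn hd hd' h⟩⟩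
  refine exists_orderIso_of_rel G ?_ ?_ ?_
  · intro x
    obtain ⟨y, hy1, hy2⟩ := exists_between_of_forall_le
      (s := insert 0 (ψ '' (D ∩ Iic x))) (t := insert 1 (ψ '' (D ∩ Ici x)))
      ⟨_, mem_insert _ _⟩ ⟨_, mem_insert _ _⟩ (by
        rintro _ (rfl | ⟨d, ⟨hd, hdx⟩, rfl⟩) _ (rfl | ⟨d', ⟨hd', hdx'⟩, rfl⟩)
        · exact zero_le_one
        · exact (ψ d').2.1
        · exact (ψ d).2.2
        · exact hψ.monotoneOn hd hd' (le_trans hdx hdx'))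
    exact ⟨y, fun d hd => ⟨fun h => hy1 (Or.inr ⟨d, ⟨hd, h⟩, rfl⟩),
      fun h => hy2 (Or.inr ⟨d, ⟨hd, h⟩, rfl⟩)⟩⟩
  · intro y
    obtain ⟨x, hx1, hx2⟩ := exists_between_of_forall_le
      (s := insert 0 {d ∈ D | ψ d ≤ y}) (t := insert 1 {d ∈ D | y ≤ ψ d})
      ⟨_, mem_insert _ _⟩ ⟨_, mem_insert _ _⟩ (by
        rintro a (rfl | ⟨hd, hdx⟩) b (rfl | ⟨hd', hdx'⟩)
        · exact zero_le_one
        · exact b.2.1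
        · exact a.2.2
        · exact (hψ.le_iff_le hd hd').1 (hdx.trans hdx'))
    refine ⟨x, fun d hd => ⟨fun h => ?_, fun h => ?_⟩⟩ <;> by_contra! hc
    · obtain ⟨a, ha, b, hb, hab, h1, h2⟩ := hD'ψ hc
      have e1 : x ≤ a := hx2 (Or.inr ⟨ha, h1.le⟩)
      exact lt_irrefl _ (((hψ.lt_iff_lt hb hd).1 h2).trans_le (h.trans (e1.trans hab.le)))
    · obtain ⟨a, ha, b, hb, hab, h1, h2⟩ := hD'ψ hc
      have e1 : b ≤ x := hx1 (Or.inr ⟨hb, h2.le⟩)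
      exact lt_irrefl _ ((((hψ.lt_iff_lt hd ha).1 h1).trans hab).trans_le (e1.trans h))
  · intro x y x' y' hxy hxy'
    constructor
    · intro h
      obtain ⟨a, ha, b, hb, h1, h2, h3⟩ := hD.exists_mem_between₂ h
      exact ((hxy a ha).2 h1.le).trans_lt ((hψ ha hb h2).trans_le ((hxy' b hb).1 h3.le))
    · intro h
      obtain ⟨a, ha, b, hb, hab, h1, h2⟩ := hD'ψ h
      have e1 : x < a := not_le.1 fun hc => ((hxy a ha).1 hc).not_gt h1
      have e2 : b < x' := not_le.1 fun hc => ((hxy' b hb).2 hc).not_gt h2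
      exact e1.trans (hab.trans e2)

/-! ### The orbits of chains on the unit interval -/

namespace Profile

/-- Two profiles have the same plateaus if an increasing reparametrization of the lengths carries
the intervals on which the left end point stays constant to such intervals, and the same for the
right end point. -/
def SamePlateaus (m m' : Profile) : Prop :=
  ∃ φ : unitInterval ≃o unitInterval, ∀ u v,
    (m.left u = m.left v ↔ m'.left (φ u) = m'.left (φ v)) ∧
    (m.right u = m.right v ↔ m'.right (φ u) = m'.right (φ v))

/-- The profile of the mirror image of a chain under `x ↦ 1 - x`. -/
def flip (m : Profile) : Profile :=
  ⟨fun u => 2 - m u, LipschitzWith.of_dist_le_mul fun u v => by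
    rw [Real.dist_eq, show 2 - m u - (2 - m v) = m v - m u by ring, abs_sub_comm]
    exact m.2.1.dist_le_mul u v, by
    change 2 - m 1 = 1
    rw [m.2.2]; norm_num⟩

theorem flip_apply (m : Profile) (u : unitInterval) : m.flip u = 2 - m u := rfl

theorem left_flip (m : Profile) (u : unitInterval) :
    m.flip.left u = unitInterval.symm (m.right u) := by
  apply Subtype.ext
  rw [coe_left, unitInterval.coe_symm_eq, coe_right, flip_apply]
  ring

theorem right_flip (m : Profile) (u : unitInterval) :
    m.flip.right u = unitInterval.symm (m.left u) := by
  apply Subtype.ext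
  rw [coe_right, unitInterval.coe_symm_eq, coe_left, flip_apply]
  ring

theorem exists_intervalChain_eq (𝒞 : ChainSpace unitInterval) :
    ∃ m : Profile, m.intervalChain = 𝒞 := by
  obtain ⟨m, hm⟩ := exists_range_arc_eq 𝒞.2
  exact ⟨m, Subtype.ext (Subcontinua.ext_coe (by rw [coe_intervalChain, hm]))⟩

theorem smul_intervalChain_eq_iff {g : unitInterval ≃ₜ unitInterval} {m m' : Profile} :
    g • m.intervalChain = m'.intervalChain ↔
      range (fun u => Subcontinua.map g g.continuous (m.arc u)) = range m'.arc := by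
  have h : (((g • m.intervalChain).1.1 : Set (Subcontinua unitInterval))) =
      range (fun u => Subcontinua.map g g.continuous (m.arc u)) := by
    rw [ChainSpace.coe_smul, coe_intervalChain, ← range_comp]
    rfl
  rw [← h, ← coe_intervalChain]
  exact ⟨fun e => by rw [e], fun e => Subtype.ext (Subcontinua.ext_coe e)⟩

theorem smul_symm_intervalChain (m : Profile) :
    unitInterval.symmHomeomorph • m.intervalChain = m.flip.intervalChain := by
  rw [smul_intervalChain_eq_iff]
  congr 1
  funext u
  rw [eq_arc_iff, Subcontinua.coe_map, coe_arc, left_flip, right_flip]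
  ext x
  constructor
  · rintro ⟨y, hy, rfl⟩
    exact ⟨unitInterval.symm_le_symm.2 hy.2, unitInterval.symm_le_symm.2 hy.1⟩
  · intro hx
    refine ⟨unitInterval.symm x, ⟨?_, ?_⟩, unitInterval.symm_symm x⟩
    · rw [← unitInterval.symm_le_symm, unitInterval.symm_symm]; exact hx.2
    · rw [← unitInterval.symm_le_symm, unitInterval.symm_symm]; exact hx.1

theorem coe_map_orderIso_arc (g : unitInterval ≃o unitInterval) (hg : Continuous g) (m : Profile)
    (u : unitInterval) : ((Subcontinua.map g hg (m.arc u)).1 : Set unitInterval) =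
      Icc (g (m.left u)) (g (m.right u)) := by
  rw [Subcontinua.coe_map, coe_arc, OrderIso.image_Icc]

theorem samePlateaus_of_smul_eq {g : unitInterval ≃ₜ unitInterval} (hg : StrictMono g)
    {m m' : Profile} (h : g • m.intervalChain = m'.intervalChain) : m.SamePlateaus m' := by
  let G : unitInterval ≃o unitInterval := hg.orderIsoOfSurjective g g.surjective
  rw [smul_intervalChain_eq_iff] at h
  have key : ∀ {u v}, Subcontinua.map g g.continuous (m.arc u) = m'.arc v →
      m'.left v = g (m.left u) ∧ m'.right v = g (m.right u) := fun {u v} e => by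
    have e := (eq_arc_iff.1 e).symm
    rw [show Subcontinua.map g g.continuous (m.arc u) =
      Subcontinua.map G G.continuous (m.arc u) from rfl, coe_map_orderIso_arc] at e
    have h1 := (Icc_subset_Icc_iff (m'.left_le_right v)).1 e.subset
    have h2 := (Icc_subset_Icc_iff (G.monotone (m.left_le_right u))).1 e.symm.subset
    exact ⟨le_antisymm h2.1 h1.1, le_antisymm h1.2 h2.2⟩
  have hle : ∀ {u v}, Subcontinua.map g g.continuous (m.arc u) ≤
      Subcontinua.map g g.continuous (m.arc v) ↔ u ≤ v := fun {u v} => by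
    rw [← arc_le_arc_iff (m := m), Subcontinua.le_iff, Subcontinua.le_iff, Subcontinua.coe_map,
      Subcontinua.coe_map]
    exact image_subset_image_iff g.injective
  obtain ⟨φ, hφ⟩ := exists_orderIso_of_rel
    (fun u v => Subcontinua.map g g.continuous (m.arc u) = m'.arc v)
    (fun u => by
      have := h ▸ mem_range_self (f := fun u => Subcontinua.map g g.continuous (m.arc u)) u
      obtain ⟨v, hv⟩ := this
      exact ⟨v, hv.symm⟩)
    (fun v => by
      have := h.symm ▸ mem_range_self (f := m'.arc) v
      exact this)
    (fun u v u' v' e e' => by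
      rw [← not_le, ← not_le, ← hle, e, e', arc_le_arc_iff])
  have hφ' : ∀ u, m'.left (φ u) = g (m.left u) ∧ m'.right (φ u) = g (m.right u) := fun u => by
    have := h ▸ mem_range_self (f := fun u => Subcontinua.map g g.continuous (m.arc u)) u
    obtain ⟨v, hv⟩ := this
    rw [hφ u v hv.symm]
    exact key hv.symm
  refine ⟨φ, fun u v => ?_⟩
  rw [(hφ' u).1, (hφ' v).1, (hφ' u).2, (hφ' v).2, g.injective.eq_iff, g.injective.eq_iff]
  exact ⟨Iff.rfl, Iff.rfl⟩

theorem exists_eq_left_or_right (m : Profile) (x : unitInterval) :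
    ∃ u, x = m.left u ∨ x = m.right u := by
  rcases le_total x (m.left 0) with h | h
  · obtain ⟨u, hu⟩ := mem_range_of_exists_le_of_exists_ge m.continuous_left (c := x)
      ⟨1, by rw [left_one]; exact x.2.1⟩ ⟨0, h⟩
    exact ⟨u, Or.inl hu.symm⟩
  · obtain ⟨u, hu⟩ := mem_range_of_exists_le_of_exists_ge m.continuous_right (c := x)
      ⟨0, by rwa [← left_zero]⟩ ⟨1, by rw [right_one]; exact x.2.2⟩
    exact ⟨u, Or.inr hu.symm⟩

/-- Left and right end points can only meet at the starting point of the chain. -/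
theorem left_eq_left_zero {m : Profile} {u v : unitInterval} (h : m.right u ≤ m.left v) :
    m.left v = m.left 0 ∧ m.right u = m.right 0 :=
  ⟨le_antisymm (m.left_anti v.2.1)
      (m.left_zero.le.trans ((m.right_mono u.2.1).trans h)),
    le_antisymm (h.trans ((m.left_anti v.2.1).trans m.left_zero.le)) (m.right_mono u.2.1)⟩

/-- If `φ` matches the plateaus of two profiles, then sending the end points of the interval of
length `u` of the first chain to those of the interval of length `φ u` of the second defines an
increasing homeomorphism of `[0,1]`. -/
theorem SamePlateaus.exists_smul_eq {m m' : Profile} (h : m.SamePlateaus m') :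
    ∃ g : unitInterval ≃ₜ unitInterval, g • m.intervalChain = m'.intervalChain := by
  obtain ⟨φ, hφ⟩ := h
  have aux : ∀ {m m' : Profile} (φ : unitInterval ≃o unitInterval), (∀ u v,
      (m.left u = m.left v ↔ m'.left (φ u) = m'.left (φ v)) ∧
      (m.right u = m.right v ↔ m'.right (φ u) = m'.right (φ v))) →
      ∀ {x y x' y' : unitInterval},
      (∃ u, x = m.left u ∧ y = m'.left (φ u) ∨ x = m.right u ∧ y = m'.right (φ u)) →
      (∃ u, x' = m.left u ∧ y' = m'.left (φ u) ∨ x' = m.right u ∧ y' = m'.right (φ u)) →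
      x ≤ x' → y ≤ y' := by
    rintro m m' φ hφ x y x' y' ⟨u, ⟨rfl, rfl⟩ | ⟨rfl, rfl⟩⟩ ⟨v, ⟨rfl, rfl⟩ | ⟨rfl, rfl⟩⟩ hle
    · rcases le_total v u with huv | huv
      · exact m'.left_anti (φ.monotone huv)
      · exact ((hφ u v).1.1 (le_antisymm hle (m.left_anti huv))).le
    · exact m'.left_le_right' _ _
    · obtain ⟨h1, h2⟩ := left_eq_left_zero hle
      have h0 : φ 0 = 0 := φ.map_bot
      rw [(hφ v 0).1.1 h1, (hφ u 0).2.1 h2, h0]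
      exact m'.left_zero.ge
    · rcases le_total u v with huv | huv
      · exact m'.right_mono (φ.monotone huv)
      · exact ((hφ u v).2.1 (le_antisymm hle (m.right_mono huv))).le
  obtain ⟨g, hg⟩ := exists_orderIso_of_rel
    (fun x y : unitInterval =>
      ∃ u, x = m.left u ∧ y = m'.left (φ u) ∨ x = m.right u ∧ y = m'.right (φ u))
    (fun x => by
      obtain ⟨u, h | h⟩ := m.exists_eq_left_or_right x
      · exact ⟨_, u, Or.inl ⟨h, rfl⟩⟩
      · exact ⟨_, u, Or.inr ⟨h, rfl⟩⟩)
    (fun y => by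
      obtain ⟨u, h | h⟩ := m'.exists_eq_left_or_right y
      · exact ⟨_, φ.symm u, Or.inl ⟨rfl, by rwa [OrderIso.apply_symm_apply]⟩⟩
      · exact ⟨_, φ.symm u, Or.inr ⟨rfl, by rwa [OrderIso.apply_symm_apply]⟩⟩)
    (fun x y x' y' h h' => by
      rw [← not_le, ← not_le, not_iff_not]
      refine ⟨aux φ hφ h' h, ?_⟩
      have inv : ∀ {x y}, (∃ u, x = m.left u ∧ y = m'.left (φ u) ∨
          x = m.right u ∧ y = m'.right (φ u)) → ∃ u, y = m'.left u ∧ x = m.left (φ.symm u) ∨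
          y = m'.right u ∧ x = m.right (φ.symm u) := by
        rintro x y ⟨u, h⟩
        refine ⟨φ u, ?_⟩
        simp only [OrderIso.symm_apply_apply]
        exact h.imp And.symm And.symm
      refine aux φ.symm (fun u v => ?_) (inv h') (inv h)
      have := hφ (φ.symm u) (φ.symm v)
      simp only [OrderIso.apply_symm_apply] at this
      exact ⟨this.1.symm, this.2.symm⟩)
  refine ⟨g.toHomeomorph, smul_intervalChain_eq_iff.2 ?_⟩
  have : ∀ u, Subcontinua.map g.toHomeomorph g.toHomeomorph.continuous (m.arc u) =
      m'.arc (φ u) := fun u => by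
    rw [eq_arc_iff]
    refine (coe_map_orderIso_arc g g.continuous m u).trans ?_
    rw [hg _ _ ⟨u, Or.inl ⟨rfl, rfl⟩⟩, hg _ _ ⟨u, Or.inr ⟨rfl, rfl⟩⟩]
  simp only [this]
  exact φ.surjective.range_comp m'.arc

/-- Two chains on `[0,1]` are in the same orbit iff their profiles have the same plateaus, up to
exchanging left and right. -/
theorem orbitRel_intervalChain_iff {m m' : Profile} :
    ChainSpace.orbitRel unitInterval m.intervalChain m'.intervalChain ↔
      m.SamePlateaus m' ∨ m.flip.SamePlateaus m' := by
  have hsymm : ChainSpace.orbitRel unitInterval m.intervalChain m'.intervalChain ↔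
      ∃ g : unitInterval ≃ₜ unitInterval, g • m.intervalChain = m'.intervalChain :=
    ⟨fun h => (ChainSpace.orbitRel unitInterval).symm h,
      fun h => (ChainSpace.orbitRel unitInterval).symm h⟩
  rw [hsymm]
  constructor
  · rintro ⟨g, hg⟩
    rcases g.continuous.strictMono_of_inj_boundedOrder' g.injective with h | h
    · exact Or.inl (samePlateaus_of_smul_eq h hg)
    · refine Or.inr (samePlateaus_of_smul_eq (g := g * unitInterval.symmHomeomorph) ?_ ?_)
      · exact fun x y hxy => h (unitInterval.symm_lt_symm.2 hxy)
      · rw [← smul_symm_intervalChain, mul_smul, smul_smul unitInterval.symmHomeomorph]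
        have : unitInterval.symmHomeomorph * unitInterval.symmHomeomorph = 1 :=
          Homeomorph.ext fun x => unitInterval.symm_symm x
        rw [this, one_smul, hg]
  · rintro (h | h)
    · exact h.exists_smul_eq
    · obtain ⟨g, hg⟩ := h.exists_smul_eq
      exact ⟨g * unitInterval.symmHomeomorph, by rw [mul_smul, smul_symm_intervalChain, hg]⟩

end Profile

/-! ### Cells of a profile -/

namespace Profile

variable {m m' : Profile}

/-- An interval `[p, q]` of lengths is homogeneous if the left end point is constant on it, or the
right end point is constant on it, or both are injective on it. -/
def Homogeneous (m : Profile) (p q : unitInterval) : Prop :=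
  m.left p = m.left q ∨ m.right p = m.right q ∨
    ∀ a b, p ≤ a → a < b → b ≤ q → m.left a ≠ m.left b ∧ m.right a ≠ m.right b

/-- The union of all open intervals containing `u` whose closure is homogeneous. It is empty if `u`
is `0` or `1` or has no homogeneous neighbourhood. -/
def cell (m : Profile) (u : unitInterval) : Set unitInterval :=
  {v | ∃ p q, p < u ∧ u < q ∧ p < v ∧ v < q ∧ m.Homogeneous p q}

theorem left_eq_of_le {p q a b : unitInterval} (h : m.left p = m.left q) (hpa : p ≤ a)
    (haq : a ≤ q) (hpb : p ≤ b) (hbq : b ≤ q) : m.left a = m.left b := by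
  have h1 := m.left_anti hpa
  have h2 := m.left_anti haq
  have h3 := m.left_anti hpb
  have h4 := m.left_anti hbq
  rw [h] at h1 h3
  exact (le_antisymm h1 h2).trans (le_antisymm h3 h4).symm

theorem right_eq_of_le {p q a b : unitInterval} (h : m.right p = m.right q) (hpa : p ≤ a)
    (haq : a ≤ q) (hpb : p ≤ b) (hbq : b ≤ q) : m.right a = m.right b := by
  have h1 := m.right_mono hpa
  have h2 := m.right_mono haq
  have h3 := m.right_mono hpb
  have h4 := m.right_mono hbq
  rw [h] at h1 h3
  exact (le_antisymm h2 h1).trans (le_antisymm h4 h3).symm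

theorem eq_of_left_eq_of_right_eq {a b : unitInterval} (h : m.left a = m.left b)
    (h' : m.right a = m.right b) : a = b := by
  apply Subtype.ext
  rw [← m.right_sub_left a, ← m.right_sub_left b, h, h']

theorem Homogeneous.mono {p q a b : unitInterval} (h : m.Homogeneous p q) (hpa : p ≤ a)
    (hab : a ≤ b) (hbq : b ≤ q) : m.Homogeneous a b := by
  rcases h with h | h | h
  · exact Or.inl (left_eq_of_le h hpa (hab.trans hbq) (hpa.trans hab) hbq)
  · exact Or.inr (Or.inl (right_eq_of_le h hpa (hab.trans hbq) (hpa.trans hab) hbq))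
  · exact Or.inr (Or.inr fun c d hc hcd hd => h c d (hpa.trans hc) hcd (hd.trans hbq))

theorem Homogeneous.left_eq {p q a b : unitInterval} (h : m.Homogeneous p q) (hpa : p ≤ a)
    (hab : a < b) (hbq : b ≤ q) (hl : m.left a = m.left b) : m.left p = m.left q := by
  rcases h with h | h | h
  · exact h
  · exact absurd (eq_of_left_eq_of_right_eq hl
      (right_eq_of_le h hpa (hab.le.trans hbq) (hpa.trans hab.le) hbq)) hab.ne
  · exact absurd hl (h a b hpa hab hbq).1

theorem Homogeneous.right_eq {p q a b : unitInterval} (h : m.Homogeneous p q) (hpa : p ≤ a)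
    (hab : a < b) (hbq : b ≤ q) (hl : m.right a = m.right b) : m.right p = m.right q := by
  rcases h with h | h | h
  · exact absurd (eq_of_left_eq_of_right_eq
      (left_eq_of_le h hpa (hab.le.trans hbq) (hpa.trans hab.le) hbq) hl) hab.ne
  · exact h
  · exact absurd hl (h a b hpa hab hbq).2

/-- Two homogeneous intervals with nondegenerate overlap are homogeneous for the same reason, which
can be read off from the overlap, and so their union is homogeneous. -/
theorem Homogeneous.union {p q p' q' : unitInterval} (h : m.Homogeneous p q)
    (h' : m.Homogeneous p' q') (h1 : p ≤ p') (h2 : p' < q) (h3 : q ≤ q') :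
    m.Homogeneous p q' := by
  by_cases hl : ∃ a b, p' ≤ a ∧ a < b ∧ b ≤ q ∧ m.left a = m.left b
  · obtain ⟨a, b, ha, hab, hb, he⟩ := hl
    have e1 := h.left_eq (h1.trans ha) hab hb he
    have e2 := h'.left_eq ha hab (hb.trans h3) he
    have e3 := left_eq_of_le e1 h1 h2.le le_rfl (h1.trans h2.le)
    exact Or.inl (e3.symm.trans e2)
  by_cases hr : ∃ a b, p' ≤ a ∧ a < b ∧ b ≤ q ∧ m.right a = m.right b
  · obtain ⟨a, b, ha, hab, hb, he⟩ := hr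
    have e1 := h.right_eq (h1.trans ha) hab hb he
    have e2 := h'.right_eq ha hab (hb.trans h3) he
    have e3 := right_eq_of_le e1 h1 h2.le le_rfl (h1.trans h2.le)
    exact Or.inr (Or.inl (e3.symm.trans e2))
  have hd : ∀ r s, (r = p ∧ s = q ∨ r = p' ∧ s = q') → m.Homogeneous r s →
      ∀ a b, r ≤ a → a < b → b ≤ s → m.left a ≠ m.left b ∧ m.right a ≠ m.right b := by
    intro r s hrs hh a b ha hab hb
    have hrp : r ≤ p' ∧ q ≤ s := by
      rcases hrs with ⟨rfl, rfl⟩ | ⟨rfl, rfl⟩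
      · exact ⟨h1, le_rfl⟩
      · exact ⟨le_rfl, h3⟩
    constructor <;> intro he
    · have e := hh.left_eq ha hab hb he
      exact hl ⟨p', q, le_rfl, h2, le_rfl,
        left_eq_of_le e hrp.1 (h2.le.trans hrp.2) (hrp.1.trans h2.le) hrp.2⟩
    · have e := hh.right_eq ha hab hb he
      exact hr ⟨p', q, le_rfl, h2, le_rfl,
        right_eq_of_le e hrp.1 (h2.le.trans hrp.2) (hrp.1.trans h2.le) hrp.2⟩
  refine Or.inr (Or.inr fun a b ha hab hb => ?_)
  rcases lt_or_ge a q with haq | haq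
  · -- the part of `[a, b]` inside `[p, q]` is nondegenerate
    have := hd p q (Or.inl ⟨rfl, rfl⟩) h a (min b q) ha (lt_min hab haq) (min_le_right _ _)
    constructor <;> intro he
    · exact this.1 (left_eq_of_le he le_rfl hab.le (lt_min hab haq).le (min_le_left _ _))
    · exact this.2 (right_eq_of_le he le_rfl hab.le (lt_min hab haq).le (min_le_left _ _))
  · exact hd p' q' (Or.inr ⟨rfl, rfl⟩) h' a b (h2.le.trans haq) hab hb

theorem Homogeneous.union' {p q p' q' a : unitInterval} (h : m.Homogeneous p q)
    (h' : m.Homogeneous p' q') (h1 : p < a) (h2 : a < q) (h3 : p' < a) (h4 : a < q') :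
    m.Homogeneous (min p p') (max q q') := by
  rcases le_total p p' with hp | hp <;> rcases le_total q q' with hq | hq
  · rw [min_eq_left hp, max_eq_right hq]
    exact h.union h' hp (h3.trans h2) hq
  · rw [min_eq_left hp, max_eq_left hq]
    exact h
  · rw [min_eq_right hp, max_eq_right hq]
    exact h'
  · rw [min_eq_right hp, max_eq_left hq]
    exact h'.union h hp (h1.trans h4) hq

theorem exists_homogeneous_of_mem_cell {u v w : unitInterval} (hv : v ∈ m.cell u)
    (hw : w ∈ m.cell u) : ∃ p q, m.Homogeneous p q ∧ p < u ∧ u < q ∧ p < v ∧ v < q ∧ p < w ∧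
      w < q := by
  obtain ⟨p, q, h1, h2, h3, h4, h⟩ := hv
  obtain ⟨p', q', h1', h2', h3', h4', h'⟩ := hw
  exact ⟨_, _, h.union' h' h1 h2 h1' h2', min_lt_of_left_lt h1, lt_max_of_lt_left h2,
    min_lt_of_left_lt h3, lt_max_of_lt_left h4, min_lt_of_right_lt h3', lt_max_of_lt_right h4'⟩

theorem mem_cell_symm {u v : unitInterval} (h : v ∈ m.cell u) : u ∈ m.cell v := by
  obtain ⟨p, q, h1, h2, h3, h4, h⟩ := h
  exact ⟨p, q, h3, h4, h1, h2, h⟩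

theorem self_mem_cell {u v : unitInterval} (h : v ∈ m.cell u) : u ∈ m.cell u := by
  obtain ⟨p, q, h1, h2, h3, h4, h⟩ := h
  exact ⟨p, q, h1, h2, h1, h2, h⟩

theorem cell_subset_of_mem {u v : unitInterval} (h : v ∈ m.cell u) : m.cell u ⊆ m.cell v := by
  intro w hw
  obtain ⟨p, q, h, _, _, h1, h2, h3, h4⟩ := exists_homogeneous_of_mem_cell h hw
  exact ⟨p, q, h1, h2, h3, h4, h⟩

theorem cell_eq_of_mem {u v : unitInterval} (h : v ∈ m.cell u) : m.cell v = m.cell u :=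
  (cell_subset_of_mem (mem_cell_symm h)).antisymm (cell_subset_of_mem h)

theorem ordConnected_cell (m : Profile) (u : unitInterval) : (m.cell u).OrdConnected := by
  refine ⟨fun v hv w hw x hx => ?_⟩
  obtain ⟨p, q, h, h1, h2, h3, _, _, h6⟩ := exists_homogeneous_of_mem_cell hv hw
  exact ⟨p, q, h1, h2, h3.trans_le hx.1, hx.2.trans_lt h6, h⟩

theorem exists_Ioo_subset_cell {u v : unitInterval} (h : v ∈ m.cell u) :
    ∃ p q, p < v ∧ v < q ∧ Ioo p q ⊆ m.cell u := by
  obtain ⟨p, q, h1, h2, h3, h4, h⟩ := h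
  exact ⟨p, q, h3, h4, fun x hx => ⟨p, q, h1, h2, hx.1, hx.2, h⟩⟩

theorem Homogeneous.mem_cell_of_overlap {p q p' q' a b : unitInterval} (h : m.Homogeneous p q)
    (h' : m.Homogeneous p' q') (hab : m.Homogeneous a b) (h1 : p < a) (h2 : a < q) (h3 : p' < b)
    (h4 : b < q') (hlt : a < b) : b ∈ m.cell a := by
  rcases le_or_gt q b with hq | hq
  · have hpb := h.union hab h1.le h2 hq
    rcases le_total p p' with hp | hp
    · exact ⟨p, q', h1, hlt.trans h4, h1.trans hlt, h4, hpb.union h' hp h3 h4.le⟩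
    · exact ⟨p', q', hp.trans_lt h1, hlt.trans h4, h3, h4, h'⟩
  · exact ⟨p, q, h1, h2, h1.trans hlt, hq, h⟩

theorem mem_cell_of_homogeneous {a b : unitInterval} (ha : a ∈ m.cell a) (hb : b ∈ m.cell b)
    (hlt : a < b) (hab : m.Homogeneous a b) : b ∈ m.cell a := by
  obtain ⟨p, q, h1, h2, _, _, h⟩ := ha
  obtain ⟨p', q', h3, h4, _, _, h'⟩ := hb
  exact h.mem_cell_of_overlap h' hab h1 h2 h3 h4 hlt

theorem left_eq_of_mem_cell {a b c d : unitInterval} (hlt : a < b) (hb : b ∈ m.cell a)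
    (h : m.left a = m.left b) (hc : c ∈ m.cell a) (hd : d ∈ m.cell a) : m.left c = m.left d := by
  have : ∀ {c}, c ∈ m.cell a → m.left c = m.left a := fun {c} hc => by
    obtain ⟨p, q, hh, h1, h2, h3, h4, h5, h6⟩ := exists_homogeneous_of_mem_cell hb hc
    exact left_eq_of_le (hh.left_eq h1.le hlt h4.le h) h5.le h6.le h1.le h2.le
  rw [this hc, this hd]

theorem right_eq_of_mem_cell {a b c d : unitInterval} (hlt : a < b) (hb : b ∈ m.cell a)
    (h : m.right a = m.right b) (hc : c ∈ m.cell a) (hd : d ∈ m.cell a) :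
    m.right c = m.right d := by
  have : ∀ {c}, c ∈ m.cell a → m.right c = m.right a := fun {c} hc => by
    obtain ⟨p, q, hh, h1, h2, h3, h4, h5, h6⟩ := exists_homogeneous_of_mem_cell hb hc
    exact right_eq_of_le (hh.right_eq h1.le hlt h4.le h) h5.le h6.le h1.le h2.le
  rw [this hc, this hd]

/-- An interval containing no pair of points with a common end point is homogeneous itself. Hence
homogeneous intervals, and so cells, are dense. -/
theorem exists_homogeneous_between (m : Profile) {u v : unitInterval} (h : u < v) :
    ∃ p q, u ≤ p ∧ p < q ∧ q ≤ v ∧ m.Homogeneous p q := by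
  by_cases hc : ∃ a b, u ≤ a ∧ a < b ∧ b ≤ v ∧ (m.left a = m.left b ∨ m.right a = m.right b)
  · obtain ⟨a, b, h1, h2, h3, h4⟩ := hc
    exact ⟨a, b, h1, h2, h3, h4.imp_right Or.inl⟩
  · push Not at hc
    exact ⟨u, v, le_rfl, h, le_rfl, Or.inr (Or.inr hc)⟩

theorem dense_inter_self_mem_cell (m : Profile) {D : Set unitInterval} (hD : Dense D) :
    Dense {u ∈ D | u ∈ m.cell u} := by
  refine dense_of_exists_between fun a b hab => ?_
  obtain ⟨p, q, h1, h2, h3, h⟩ := m.exists_homogeneous_between hab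
  obtain ⟨d, hd, h4, h5⟩ := hD.exists_between h2
  exact ⟨d, ⟨hd, p, q, h4, h5, h4, h5, h⟩, h1.trans_lt h4, h5.trans_le h3⟩

theorem left_flip_eq_iff {a b : unitInterval} :
    m.flip.left a = m.flip.left b ↔ m.right a = m.right b := by
  rw [left_flip, left_flip, unitInterval.symm_inj]

theorem right_flip_eq_iff {a b : unitInterval} :
    m.flip.right a = m.flip.right b ↔ m.left a = m.left b := by
  rw [right_flip, right_flip, unitInterval.symm_inj]

theorem homogeneous_flip {p q : unitInterval} : m.flip.Homogeneous p q ↔ m.Homogeneous p q := by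
  simp only [Homogeneous, left_flip_eq_iff, right_flip_eq_iff, ne_eq, and_comm, or_left_comm]

theorem cell_flip (m : Profile) : m.flip.cell = m.cell := by
  funext u
  simp only [cell, homogeneous_flip]

/-! ### Matching countable dense sets of lengths cell by cell -/

/-- By Cantor's theorem, the traces of a countable dense set on two open intervals are order
isomorphic. -/
theorem exists_strictMonoOn_image_eq {D : Set unitInterval} (hc : D.Countable) (hD : Dense D)
    {S T : Set unitInterval} (hS : S.OrdConnected) (hT : T.OrdConnected) (hSn : S.Nonempty)
    (hTn : T.Nonempty)
    (hS' : ∀ v ∈ S, ∃ p q, p < v ∧ v < q ∧ Ioo p q ⊆ S)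
    (hT' : ∀ v ∈ T, ∃ p q, p < v ∧ v < q ∧ Ioo p q ⊆ T) :
    ∃ f : unitInterval → unitInterval, StrictMonoOn f (D ∩ S) ∧ f '' (D ∩ S) = D ∩ T := by
  have inst : ∀ {S : Set unitInterval}, S.OrdConnected → S.Nonempty →
      (∀ v ∈ S, ∃ p q, p < v ∧ v < q ∧ Ioo p q ⊆ S) →
      Countable ↥(D ∩ S) ∧ DenselyOrdered ↥(D ∩ S) ∧ NoMinOrder ↥(D ∩ S) ∧
        NoMaxOrder ↥(D ∩ S) ∧ Nonempty ↥(D ∩ S) := by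
    intro S hS ⟨v, hv⟩ hS'
    have key : ∀ v ∈ S, (∃ d ∈ D ∩ S, d < v) ∧ ∃ d ∈ D ∩ S, v < d := by
      intro v hv
      obtain ⟨p, q, hp, hq, hpq⟩ := hS' v hv
      obtain ⟨d, hd, h1, h2⟩ := hD.exists_between hp
      obtain ⟨d', hd', h1', h2'⟩ := hD.exists_between hq
      exact ⟨⟨d, ⟨hd, hpq ⟨h1, h2.trans hq⟩⟩, h2⟩, ⟨d', ⟨hd', hpq ⟨hp.trans h1', h2'⟩⟩, h1'⟩⟩
    refine ⟨(hc.mono inter_subset_left).to_subtype, ⟨?_⟩, ⟨?_⟩, ⟨?_⟩, ?_⟩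
    · rintro ⟨a, ha⟩ ⟨b, hb⟩ hab
      obtain ⟨d, hd, h1, h2⟩ := hD.exists_between (show a < b from hab)
      exact ⟨⟨d, hd, hS.out ha.2 hb.2 ⟨h1.le, h2.le⟩⟩, h1, h2⟩
    · rintro ⟨a, ha⟩
      obtain ⟨d, hd, h⟩ := (key a ha.2).1
      exact ⟨⟨d, hd⟩, h⟩
    · rintro ⟨a, ha⟩
      obtain ⟨d, hd, h⟩ := (key a ha.2).2
      exact ⟨⟨d, hd⟩, h⟩
    · obtain ⟨d, hd, _⟩ := (key v hv).1
      exact ⟨⟨d, hd⟩⟩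
  obtain ⟨_, _, _, _, _⟩ := inst hS hSn hS'
  obtain ⟨_, _, _, _, _⟩ := inst hT hTn hT'
  obtain ⟨f⟩ := Order.iso_of_countable_dense ↥(D ∩ S) ↥(D ∩ T)
  classical
  refine ⟨fun x => if hx : x ∈ D ∩ S then f ⟨x, hx⟩ else x, fun x hx y hy hxy => ?_, ?_⟩
  · simp only [hx, hy, dif_pos]
    exact f.strictMono (show (⟨x, hx⟩ : ↥(D ∩ S)) < ⟨y, hy⟩ from hxy)
  · ext y
    constructor
    · rintro ⟨x, hx, rfl⟩
      simp only [hx, dif_pos]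
      exact (f ⟨x, hx⟩).2
    · intro hy
      refine ⟨f.symm ⟨y, hy⟩, (f.symm ⟨y, hy⟩).2, ?_⟩
      simp only [Subtype.coe_prop, dif_pos, Subtype.coe_eta, OrderIso.apply_symm_apply]

theorem homogeneous_map_iff {φ : unitInterval ≃o unitInterval}
    (hφ : ∀ u v, (m.left u = m.left v ↔ m'.left (φ u) = m'.left (φ v)) ∧
      (m.right u = m.right v ↔ m'.right (φ u) = m'.right (φ v))) {p q : unitInterval} :
    m'.Homogeneous (φ p) (φ q) ↔ m.Homogeneous p q := by
  simp only [Homogeneous, ne_eq]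
  rw [(hφ p q).1, (hφ p q).2]
  refine or_congr Iff.rfl (or_congr Iff.rfl ⟨fun h a b h1 h2 h3 => ?_, fun h a b h1 h2 h3 => ?_⟩)
  · rw [(hφ a b).1, (hφ a b).2]
    exact h _ _ (φ.monotone h1) (φ.strictMono h2) (φ.monotone h3)
  · have := h (φ.symm a) (φ.symm b) (φ.le_symm_apply.2 h1) (φ.symm.strictMono h2)
      (φ.symm_apply_le.2 h3)
    rwa [(hφ _ _).1, (hφ _ _).2, φ.apply_symm_apply, φ.apply_symm_apply] at this

theorem map_mem_cell_iff {φ : unitInterval ≃o unitInterval}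
    (hφ : ∀ u v, (m.left u = m.left v ↔ m'.left (φ u) = m'.left (φ v)) ∧
      (m.right u = m.right v ↔ m'.right (φ u) = m'.right (φ v))) {u v : unitInterval} :
    φ v ∈ m'.cell (φ u) ↔ v ∈ m.cell u := by
  constructor
  · rintro ⟨p, q, h1, h2, h3, h4, h⟩
    refine ⟨φ.symm p, φ.symm q, φ.symm_apply_lt.2 h1, φ.lt_symm_apply.2 h2, φ.symm_apply_lt.2 h3,
      φ.lt_symm_apply.2 h4, ?_⟩
    rwa [← homogeneous_map_iff hφ, φ.apply_symm_apply, φ.apply_symm_apply]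
  · rintro ⟨p, q, h1, h2, h3, h4, h⟩
    exact ⟨φ p, φ q, φ.strictMono h1, φ.strictMono h2, φ.strictMono h3, φ.strictMono h4,
      (homogeneous_map_iff hφ).2 h⟩

/-- A matching `φ` of the plateaus can be replaced, on the points of a countable dense set lying in
cells, by an order isomorphism `ψ` preserving this countable set: `ψ` maps the cell of `u` to the
cell of `φ u`, and hence matches plateaus as well. -/
theorem SamePlateaus.exists_strictMonoOn {D : Set unitInterval} (hc : D.Countable) (hD : Dense D)
    (h : m.SamePlateaus m') :
    ∃ ψ : unitInterval → unitInterval, StrictMonoOn ψ {u ∈ D | u ∈ m.cell u} ∧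
      ψ '' {u ∈ D | u ∈ m.cell u} = {u ∈ D | u ∈ m'.cell u} ∧
      ∀ a ∈ {u ∈ D | u ∈ m.cell u}, ∀ b ∈ {u ∈ D | u ∈ m.cell u}, a < b →
        (m.left a = m.left b ↔ m'.left (ψ a) = m'.left (ψ b)) ∧
        (m.right a = m.right b ↔ m'.right (ψ a) = m'.right (ψ b)) := by
  obtain ⟨φ, hφ⟩ := h
  have hcell : ∀ {u v}, φ v ∈ m'.cell (φ u) ↔ v ∈ m.cell u := map_mem_cell_iff hφ
  have hf : ∀ S T : Set unitInterval, ∃ f : unitInterval → unitInterval,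
      (∃ u ∈ m.cell u, m.cell u = S) → (∃ u ∈ m'.cell u, m'.cell u = T) →
        StrictMonoOn f (D ∩ S) ∧ f '' (D ∩ S) = D ∩ T := by
    intro S T
    by_cases hST : (∃ u ∈ m.cell u, m.cell u = S) ∧ (∃ u ∈ m'.cell u, m'.cell u = T)
    · obtain ⟨⟨u, hu, rfl⟩, ⟨v, hv, rfl⟩⟩ := hST
      obtain ⟨f, hf⟩ := exists_strictMonoOn_image_eq hc hD (m.ordConnected_cell u)
        (m'.ordConnected_cell v) ⟨u, hu⟩ ⟨v, hv⟩ (fun _ => exists_Ioo_subset_cell)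
        (fun _ => exists_Ioo_subset_cell)
      exact ⟨f, fun _ _ => hf⟩
    · exact ⟨id, fun h1 h2 => absurd ⟨h1, h2⟩ hST⟩
  choose f hf using hf
  have hf' : ∀ {u}, u ∈ m.cell u →
      StrictMonoOn (f (m.cell u) (m'.cell (φ u))) (D ∩ m.cell u) ∧
        f (m.cell u) (m'.cell (φ u)) '' (D ∩ m.cell u) = D ∩ m'.cell (φ u) := fun {u} hu =>
    hf _ _ ⟨u, hu, rfl⟩ ⟨φ u, hcell.2 hu, rfl⟩
  let ψ : unitInterval → unitInterval := fun x => f (m.cell x) (m'.cell (φ x)) x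
  have hψ : ∀ {x}, x ∈ D → x ∈ m.cell x → ψ x ∈ D ∩ m'.cell (φ x) := fun {x} hx hx' =>
    (hf' hx').2 ▸ mem_image_of_mem _ ⟨hx, hx'⟩
  have hψcell : ∀ {x y}, y ∈ m.cell x → ψ y = f (m.cell x) (m'.cell (φ x)) y := fun {x y} h => by
    simp only [ψ]
    rw [cell_eq_of_mem h, cell_eq_of_mem (hcell.2 h)]
  have hmono : StrictMonoOn ψ {u ∈ D | u ∈ m.cell u} := by
    intro x hx y hy hxy
    by_cases hxy' : y ∈ m.cell x
    · rw [hψcell hxy', hψcell hx.2]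
      exact (hf' hx.2).1 hx ⟨hy.1, hxy'⟩ hxy
    · have h1 := (hψ hx.1 hx.2).2
      have h2 := (hψ hy.1 hy.2).2
      have hne : φ y ∉ m'.cell (φ x) := fun h => hxy' (hcell.1 h)
      by_contra! hle
      rcases le_or_gt (ψ y) (φ x) with h | h
      · -- `φ x` lies between two points of the cell of `φ y`
        have := (m'.ordConnected_cell (φ y)).out h2 (hcell.2 hy.2) ⟨h, φ.monotone hxy.le⟩
        exact hne (mem_cell_symm this)
      · -- `ψ y` lies between two points of the cell of `φ x`
        have := (m'.ordConnected_cell (φ x)).out (hcell.2 hx.2) h1 ⟨h.le, hle⟩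
        rw [← cell_eq_of_mem this, cell_eq_of_mem h2] at hne
        exact hne (hcell.2 hy.2)
  refine ⟨ψ, hmono, ?_, fun a ha b hb hab => ?_⟩
  · ext y
    constructor
    · rintro ⟨x, hx, rfl⟩
      have := hψ hx.1 hx.2
      exact ⟨this.1, by rw [cell_eq_of_mem this.2]; exact this.2⟩
    · rintro ⟨hyD, hy⟩
      obtain ⟨u, rfl⟩ := φ.surjective y
      have hu := hcell.1 hy
      obtain ⟨x, hx, hxy⟩ : φ u ∈ f (m.cell u) (m'.cell (φ u)) '' (D ∩ m.cell u) := by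
        rw [(hf' hu).2]; exact ⟨hyD, hy⟩
      refine ⟨x, ⟨hx.1, ?_⟩, by rw [hψcell hx.2, hxy]⟩
      rw [cell_eq_of_mem hx.2]; exact hx.2
  · have hlt := hmono ha hb hab
    have h1 := (hψ ha.1 ha.2).2
    have h2 := (hψ hb.1 hb.2).2
    have h1' : ψ a ∈ m'.cell (ψ a) := self_mem_cell (mem_cell_symm h1)
    have h2' : ψ b ∈ m'.cell (ψ b) := self_mem_cell (mem_cell_symm h2)
    have key1 : m.Homogeneous a b → φ b ∈ m'.cell (φ a) ∧ ψ b ∈ m'.cell (φ a) := fun h => by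
      have h3 := hcell.2 (mem_cell_of_homogeneous ha.2 hb.2 hab h)
      exact ⟨h3, by rwa [← cell_eq_of_mem h3]⟩
    have key2 : m'.Homogeneous (ψ a) (ψ b) → ψ b ∈ m'.cell (ψ a) ∧ φ a ∈ m'.cell (ψ a) ∧
        φ b ∈ m'.cell (ψ a) := fun h => by
      have h3 := mem_cell_of_homogeneous h1' h2' hlt h
      refine ⟨h3, mem_cell_symm h1, ?_⟩
      rw [← cell_eq_of_mem h3]
      exact mem_cell_symm h2
    refine ⟨⟨fun h => ?_, fun h => ?_⟩, ⟨fun h => ?_, fun h => ?_⟩⟩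
    · obtain ⟨h3, h4⟩ := key1 (Or.inl h)
      exact left_eq_of_mem_cell (φ.strictMono hab) h3 ((hφ a b).1.1 h) h1 h4
    · obtain ⟨h3, h4, h5⟩ := key2 (Or.inl h)
      exact (hφ a b).1.2 (left_eq_of_mem_cell hlt h3 h h4 h5)
    · obtain ⟨h3, h4⟩ := key1 (Or.inr (Or.inl h))
      exact right_eq_of_mem_cell (φ.strictMono hab) h3 ((hφ a b).2.1 h) h1 h4
    · obtain ⟨h3, h4, h5⟩ := key2 (Or.inr (Or.inl h))
      exact (hφ a b).2.2 (right_eq_of_mem_cell hlt h3 h h4 h5)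

end Profile

/-! ### Coding a profile by a countable structure -/

/-- The relation symbols of the language used to code profiles: an order relation `le`, and a
relation `same` saying that two pairs of points span plateaus of the same end point. -/
inductive PlateauRel : ℕ → Type
  | le : PlateauRel 2
  | same : PlateauRel 4

/-- The relational language with symbols `PlateauRel`. -/
def plateauLanguage : FirstOrder.Language.{0, 0} := ⟨fun _ => Empty, PlateauRel⟩

instance : plateauLanguage.IsRelational := fun _ => inferInstanceAs (IsEmpty Empty)

theorem countable_plateauLanguage : Countable (Σ n : ℕ, plateauLanguage.Relations n) := by
  refine Function.Injective.countable (f := fun R : Σ n : ℕ, plateauLanguage.Relations n => R.1) ?_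
  rintro ⟨_, (_ | _)⟩ ⟨_, (_ | _)⟩ h
  · rfl
  · exact absurd h (by decide)
  · exact absurd h (by decide)
  · rfl

theorem ModSpace.iso_iff {L : FirstOrder.Language.{0, 0}} [L.IsRelational] {M N : ModSpace L} :
    M.Iso N ↔ ∃ σ : ℕ ≃ ℕ, ∀ R v, M R v = N R (σ ∘ v) := by
  constructor
  · rintro ⟨σ⟩
    exact ⟨@FirstOrder.Language.Equiv.toEquiv L ℕ ℕ M.toStructure N.toStructure σ, fun R v =>
      Bool.eq_iff_iff.2 (@FirstOrder.Language.Equiv.map_rel' L ℕ ℕ M.toStructure N.toStructure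
        σ R.1 R.2 v).symm⟩
  · rintro ⟨σ, h⟩
    exact ⟨@FirstOrder.Language.Equiv.mk L ℕ ℕ M.toStructure N.toStructure σ
      (fun f => isEmptyElim f) fun {n} R v => Bool.eq_iff_iff.1 (h ⟨n, R⟩ v).symm⟩

namespace Profile

variable {m m' : Profile} {A : Set ℕ} {pt : ℕ → unitInterval}

/-- The indices `n ∈ A` for which `pt n` lies in a cell. The other natural numbers take part
in no relation of the coding structure. -/
def live (A : Set ℕ) (pt : ℕ → unitInterval) (m : Profile) : Set ℕ :=
  {n ∈ A | pt n ∈ m.cell (pt n)}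

/-- The order relation of the coding structure. -/
def CodeLE (A : Set ℕ) (pt : ℕ → unitInterval) (m : Profile) (a b : ℕ) : Prop :=
  a ∈ m.live A pt ∧ b ∈ m.live A pt ∧ pt a ≤ pt b

/-- The pairs of indices that span a nondegenerate interval with end points in cells. -/
def codePairs (A : Set ℕ) (pt : ℕ → unitInterval) (m : Profile) : Set (ℕ × ℕ) :=
  {x | x.1 ∈ m.live A pt ∧ x.2 ∈ m.live A pt ∧ pt x.1 < pt x.2}

/-- Two pairs of indices span plateaus of the same end point. The relation does not reveal which of
the two end points it is, since a homeomorphism of `[0,1]` may exchange them. -/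
def CodeSame (A : Set ℕ) (pt : ℕ → unitInterval) (m : Profile) (x y : ℕ × ℕ) : Prop :=
  x ∈ m.codePairs A pt ∧ y ∈ m.codePairs A pt ∧
    (m.left (pt x.1) = m.left (pt x.2) ∧ m.left (pt y.1) = m.left (pt y.2) ∨
      m.right (pt x.1) = m.right (pt x.2) ∧ m.right (pt y.1) = m.right (pt y.2))

open Classical in
/-- The structure coding a profile. The domain is `ℕ`, where `n ∈ A` stands for the length `pt n`; the
structure is used for `pt` injective on `A` with dense image and `A` of infinite complement. -/
def code (A : Set ℕ) (pt : ℕ → unitInterval) (m : Profile) : ModSpace plateauLanguage :=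
  fun R v => match R, v with
    | ⟨_, PlateauRel.le⟩, v => decide (m.CodeLE A pt (v 0) (v 1))
    | ⟨_, PlateauRel.same⟩, v => decide (m.CodeSame A pt (v 0, v 1) (v 2, v 3))

theorem iso_code_iff : (m.code A pt).Iso (m'.code A pt) ↔ ∃ σ : ℕ ≃ ℕ,
    (∀ a b, m.CodeLE A pt a b ↔ m'.CodeLE A pt (σ a) (σ b)) ∧
    ∀ a b c d, m.CodeSame A pt (a, b) (c, d) ↔ m'.CodeSame A pt (σ a, σ b) (σ c, σ d) := by
  rw [ModSpace.iso_iff]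
  refine exists_congr fun σ => ⟨fun h => ⟨fun a b => ?_, fun a b c d => ?_⟩, ?_⟩
  · exact decide_eq_decide.1 (h ⟨2, PlateauRel.le⟩ ![a, b])
  · exact decide_eq_decide.1 (h ⟨4, PlateauRel.same⟩ ![a, b, c, d])
  · rintro ⟨h1, h2⟩ ⟨_, (_ | _)⟩ v
    · exact decide_eq_decide.2 (h1 _ _)
    · exact decide_eq_decide.2 (h2 _ _ _ _)

theorem live_flip (m : Profile) : m.flip.live A pt = m.live A pt := by
  simp only [live, cell_flip]

theorem code_flip (m : Profile) : m.flip.code A pt = m.code A pt := by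
  funext R v
  rcases R with ⟨_, (_ | _)⟩
  · refine decide_eq_decide.2 ?_
    simp only [CodeLE, live_flip]
  · refine decide_eq_decide.2 ?_
    simp only [CodeSame, codePairs, live_flip, left_flip_eq_iff, right_flip_eq_iff, or_comm]

theorem image_live (m : Profile) :
    pt '' m.live A pt = {u ∈ pt '' A | u ∈ m.cell u} := by
  ext x
  constructor
  · rintro ⟨n, hn, rfl⟩
    exact ⟨⟨n, hn.1, rfl⟩, hn.2⟩
  · rintro ⟨⟨n, hn, rfl⟩, h⟩
    exact ⟨n, ⟨hn, h⟩, rfl⟩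

theorem exists_equiv_extending {N N' : Set ℕ} {τ : ℕ → ℕ} (h : BijOn τ N N')
    (hN : Nᶜ.Infinite) (hN' : N'ᶜ.Infinite) :
    ∃ σ : ℕ ≃ ℕ, EqOn σ τ N ∧ ∀ n, n ∈ N ↔ σ n ∈ N' := by
  classical
  have := hN.to_subtype
  have := hN'.to_subtype
  obtain ⟨e⟩ : Nonempty (↥Nᶜ ≃ ↥N'ᶜ) := nonempty_equiv_of_countable
  let σ : ℕ ≃ ℕ := (Equiv.Set.sumCompl N).symm.trans
    ((Equiv.sumCongr (h.equiv τ) e).trans (Equiv.Set.sumCompl N'))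
  have h1 : ∀ n (hn : n ∈ N), σ n = τ n := fun n hn => by
    simp only [σ, Equiv.trans_apply, Equiv.Set.sumCompl_symm_apply_of_mem hn, Equiv.sumCongr_apply,
      Sum.map_inl, Equiv.Set.sumCompl_apply_inl]
    rfl
  have h2 : ∀ n (hn : n ∉ N), σ n ∉ N' := fun n hn => by
    simp only [σ, Equiv.trans_apply, Equiv.Set.sumCompl_symm_apply_of_notMem hn,
      Equiv.sumCongr_apply, Sum.map_inr, Equiv.Set.sumCompl_apply_inr]
    exact (e ⟨n, hn⟩).2
  refine ⟨σ, h1, fun n => ⟨fun hn => ?_, fun hn => by_contra fun hc => h2 n hc hn⟩⟩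
  rw [h1 n hn]
  exact h.1 hn

/-- The matching of the points in cells extends to a permutation of `ℕ`, as infinitely many natural
numbers are left over on both sides. -/
theorem SamePlateaus.iso_code (hinj : InjOn pt A) (hA : Dense (pt '' A)) (hAc : Aᶜ.Infinite)
    (h : m.SamePlateaus m') : (m.code A pt).Iso (m'.code A pt) := by
  obtain ⟨ψ, hψ, himg, hplat⟩ := h.exists_strictMonoOn (A.to_countable.image pt) hA
  rw [← image_live, ← image_live] at himg
  rw [← image_live] at hψ hplat
  have hbij : BijOn (fun n => Function.invFunOn pt (m'.live A pt) (ψ (pt n))) (m.live A pt)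
      (m'.live A pt) := by
    have hsub : m.live A pt ⊆ A := fun n hn => hn.1
    have hex : ∀ n ∈ m.live A pt, ψ (pt n) ∈ pt '' m'.live A pt := fun n hn =>
      himg ▸ mem_image_of_mem ψ (mem_image_of_mem pt hn)
    refine ⟨fun n hn => Function.invFunOn_mem (hex n hn), fun a ha b hb hab => ?_, fun k hk => ?_⟩
    · have hab := congrArg pt hab
      simp only [Function.invFunOn_eq (hex a ha), Function.invFunOn_eq (hex b hb)] at hab
      exact hinj (hsub ha) (hsub hb)
        (hψ.injOn (mem_image_of_mem pt ha) (mem_image_of_mem pt hb) hab)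
    · obtain ⟨_, ⟨n, hn, rfl⟩, he⟩ : pt k ∈ ψ '' (pt '' m.live A pt) :=
        himg ▸ mem_image_of_mem pt hk
      refine ⟨n, hn, hinj (Function.invFunOn_mem (hex n hn)).1 hk.1 ?_⟩
      rw [Function.invFunOn_eq (hex n hn), he]
  have hinf : ∀ m : Profile, (m.live A pt)ᶜ.Infinite := fun m =>
    hAc.mono (compl_subset_compl.2 fun n hn => hn.1)
  obtain ⟨σ, hσ, hlive⟩ := exists_equiv_extending hbij (hinf m) (hinf m')
  have hpt : ∀ n ∈ m.live A pt, pt (σ n) = ψ (pt n) := fun n hn => by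
    rw [hσ hn]
    have hex : ψ (pt n) ∈ pt '' m'.live A pt :=
      himg ▸ mem_image_of_mem ψ (mem_image_of_mem pt hn)
    exact Function.invFunOn_eq hex
  have himage : ∀ {n}, n ∈ m.live A pt → pt n ∈ pt '' m.live A pt := fun h =>
    mem_image_of_mem pt h
  have hpairs : ∀ a b, (a, b) ∈ m.codePairs A pt ↔ (σ a, σ b) ∈ m'.codePairs A pt := fun a b => by
    simp only [codePairs, mem_ofPred_eq, ← hlive]
    refine and_congr_right fun ha => and_congr_right fun hb => ?_
    rw [hpt a ha, hpt b hb, hψ.lt_iff_lt (himage ha) (himage hb)]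
  refine iso_code_iff.2 ⟨σ, fun a b => ?_, fun a b c d => ?_⟩
  · simp only [CodeLE, ← hlive]
    refine and_congr_right fun ha => and_congr_right fun hb => ?_
    rw [hpt a ha, hpt b hb, hψ.le_iff_le (himage ha) (himage hb)]
  · simp only [CodeSame, ← hpairs]
    refine and_congr_right fun h1 => and_congr_right fun h2 => ?_
    have e1 := hplat _ (himage h1.1) _ (himage h1.2.1) h1.2.2
    have e2 := hplat _ (himage h2.1) _ (himage h2.2.1) h2.2.2
    rw [hpt _ h1.1, hpt _ h1.2.1, hpt _ h2.1, hpt _ h2.2.1, e1.1, e1.2, e2.1, e2.2]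

/-- Let `f` have convex level sets and `f'` be continuous. If `φ` maps pairs in a dense set on which
`f` agrees to pairs on which `f'` agrees, then it does so for all pairs. -/
theorem eq_of_dense {E : Set unitInterval} (hE : Dense E) {f f' : unitInterval → unitInterval}
    (hf : ∀ {p q a b}, f p = f q → p ≤ a → a ≤ q → p ≤ b → b ≤ q → f a = f b)
    (hf' : Continuous f') (φ : unitInterval ≃o unitInterval)
    (h : ∀ a ∈ E, ∀ b ∈ E, a < b → f a = f b → f' (φ a) = f' (φ b)) {u v : unitInterval}
    (huv : f u = f v) : f' (φ u) = f' (φ v) := by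
  wlog hlt : u < v generalizing u v
  · rcases (not_lt.1 hlt).eq_or_lt with e | e
    · rw [e]
    · exact (this huv.symm e).symm
  obtain ⟨d, hd, h1, h2⟩ := hE.exists_between hlt
  have hclosed : IsClosed {x | f' (φ x) = f' (φ d)} :=
    isClosed_eq (hf'.comp φ.continuous) continuous_const
  have hsub : Icc u v ⊆ {x | f' (φ x) = f' (φ d)} := by
    rw [← closure_Ioo hlt.ne]
    refine closure_minimal ((hE.open_subset_closure_inter isOpen_Ioo).trans
      (closure_minimal ?_ hclosed)) hclosed
    rintro x ⟨hx, hxE⟩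
    have hfx : f x = f d := hf huv hx.1.le hx.2.le h1.le h2.le
    rcases lt_trichotomy x d with e | e | e
    · exact h x hxE d hd e hfx
    · rw [e]; rfl
    · exact (h d hd x hxE e hfx.symm).symm
  exact (hsub ⟨le_rfl, hlt.le⟩).trans (hsub ⟨hlt.le, le_rfl⟩).symm

/-- An isomorphism of the order relations of the codes that matches plateaus extends by density to a
reparametrization of the lengths. -/
theorem samePlateaus_of_equiv (hA : Dense (pt '' A)) (σ : ℕ ≃ ℕ)
    (hle : ∀ a b, m.CodeLE A pt a b ↔ m'.CodeLE A pt (σ a) (σ b))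
    (hplat : ∀ x ∈ m.codePairs A pt,
      (m.left (pt x.1) = m.left (pt x.2) ↔ m'.left (pt (σ x.1)) = m'.left (pt (σ x.2))) ∧
      (m.right (pt x.1) = m.right (pt x.2) ↔ m'.right (pt (σ x.1)) = m'.right (pt (σ x.2)))) :
    m.SamePlateaus m' := by
  have hlive : ∀ n, n ∈ m.live A pt ↔ σ n ∈ m'.live A pt := fun n => by
    have := hle n n
    simpa only [CodeLE, le_refl, and_true, and_self] using this
  have hpt : ∀ {a b}, a ∈ m.live A pt → b ∈ m.live A pt →
      (pt a ≤ pt b ↔ pt (σ a) ≤ pt (σ b)) := fun {a b} ha hb => by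
    have := hle a b
    simpa only [CodeLE, ← hlive, ha, hb, true_and] using this
  have hD : ∀ m : Profile, Dense (pt '' m.live A pt) := fun m => by
    rw [image_live]
    exact m.dense_inter_self_mem_cell hA
  let i : unitInterval → ℕ := Function.invFunOn pt (m.live A pt)
  have hi : ∀ {x}, x ∈ pt '' m.live A pt → i x ∈ m.live A pt ∧ pt (i x) = x := fun hx =>
    ⟨Function.invFunOn_mem hx, Function.invFunOn_eq hx⟩
  have hiσ : ∀ {n}, n ∈ m.live A pt → pt (σ (i (pt n))) = pt (σ n) := fun {n} hn => by
    obtain ⟨h1, h2⟩ := hi (mem_image_of_mem pt hn)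
    exact le_antisymm ((hpt h1 hn).1 h2.le) ((hpt hn h1).1 h2.ge)
  obtain ⟨φ, hφ⟩ := exists_orderIso_extending (ψ := fun x => pt (σ (i x))) (hD m) (hD m')
    (by
      rintro _ ⟨a, ha, rfl⟩ _ ⟨b, hb, rfl⟩ hab
      change pt (σ (i (pt a))) < pt (σ (i (pt b)))
      rw [hiσ ha, hiσ hb]
      exact not_le.1 fun h => ((hpt hb ha).2 h).not_gt hab)
    (by
      ext y
      constructor
      · rintro ⟨_, ⟨a, ha, rfl⟩, rfl⟩
        exact ⟨σ a, (hlive a).1 ha, (hiσ ha).symm⟩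
      · rintro ⟨n, hn, rfl⟩
        obtain ⟨a, rfl⟩ := σ.surjective n
        have ha := (hlive a).2 hn
        exact ⟨pt a, mem_image_of_mem pt ha, hiσ ha⟩)
  have hφ' : ∀ {n}, n ∈ m.live A pt → φ (pt n) = pt (σ n) := fun {n} hn => by
    rw [hφ (mem_image_of_mem pt hn)]
    exact hiσ hn
  have hlr : ∀ a ∈ pt '' m.live A pt, ∀ b ∈ pt '' m.live A pt, a < b →
      (m.left a = m.left b ↔ m'.left (φ a) = m'.left (φ b)) ∧
      (m.right a = m.right b ↔ m'.right (φ a) = m'.right (φ b)) := by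
    rintro _ ⟨a, ha, rfl⟩ _ ⟨b, hb, rfl⟩ hab
    rw [hφ' ha, hφ' hb]
    exact hplat (a, b) ⟨ha, hb, hab⟩
  have himg : ∀ a ∈ pt '' m'.live A pt, φ.symm a ∈ pt '' m.live A pt := by
    rintro _ ⟨n, hn, rfl⟩
    obtain ⟨a, rfl⟩ := σ.surjective n
    have ha := (hlive a).2 hn
    rw [← hφ' ha, φ.symm_apply_apply]
    exact mem_image_of_mem pt ha
  have hlr' : ∀ a ∈ pt '' m'.live A pt, ∀ b ∈ pt '' m'.live A pt, a < b →
      (m'.left a = m'.left b → m.left (φ.symm a) = m.left (φ.symm b)) ∧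
      (m'.right a = m'.right b → m.right (φ.symm a) = m.right (φ.symm b)) := by
    intro a ha b hb hab
    have := hlr _ (himg a ha) _ (himg b hb) (φ.symm.strictMono hab)
    rw [φ.apply_symm_apply, φ.apply_symm_apply] at this
    exact ⟨this.1.2, this.2.2⟩
  refine ⟨φ, fun u v => ⟨⟨fun h => ?_, fun h => ?_⟩, ⟨fun h => ?_, fun h => ?_⟩⟩⟩
  · exact eq_of_dense (hD m) left_eq_of_le m'.continuous_left φ
      (fun a ha b hb hab => (hlr a ha b hb hab).1.1) h
  · have := eq_of_dense (hD m') left_eq_of_le m.continuous_left φ.symm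
      (fun a ha b hb hab => (hlr' a ha b hb hab).1) h
    rwa [φ.symm_apply_apply, φ.symm_apply_apply] at this
  · exact eq_of_dense (hD m) right_eq_of_le m'.continuous_right φ
      (fun a ha b hb hab => (hlr a ha b hb hab).2.1) h
  · have := eq_of_dense (hD m') right_eq_of_le m.continuous_right φ.symm
      (fun a ha b hb hab => (hlr' a ha b hb hab).2) h
    rwa [φ.symm_apply_apply, φ.symm_apply_apply] at this

/-- Two disjoint properties of the elements of `X` are determined, up to exchanging them, by the
relation of sharing one of them. -/
theorem _root_.forall_iff_or_forall_iff_swap {α : Type*} {X : Set α} {L R L' R' : α → Prop}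
    (hd : ∀ x ∈ X, ¬(L x ∧ R x)) (hd' : ∀ x ∈ X, ¬(L' x ∧ R' x))
    (h : ∀ x ∈ X, ∀ y ∈ X, (L x ∧ L y ∨ R x ∧ R y) ↔ (L' x ∧ L' y ∨ R' x ∧ R' y)) :
    (∀ x ∈ X, (L x ↔ L' x) ∧ (R x ↔ R' x)) ∨ ∀ x ∈ X, (L x ↔ R' x) ∧ (R x ↔ L' x) := by
  by_cases h0 : ∃ x ∈ X, L x ∨ R x
  · obtain ⟨x, hx, hLR⟩ := h0
    have a1 := hd x hx
    have a2 := hd' x hx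
    have a3 := h x hx x hx
    by_cases hc : (L x ∧ L' x) ∨ (R x ∧ R' x)
    · refine Or.inl fun y hy => ?_
      have b1 := hd y hy
      have b2 := hd' y hy
      have b3 := h y hy y hy
      have b4 := h x hx y hy
      grind
    · refine Or.inr fun y hy => ?_
      have b1 := hd y hy
      have b2 := hd' y hy
      have b3 := h y hy y hy
      have b4 := h x hx y hy
      grind
  · push Not at h0
    refine Or.inl fun y hy => ?_
    have b1 := h0 y hy
    have b3 := h y hy y hy
    grind

theorem samePlateaus_or_of_iso (hA : Dense (pt '' A)) (h : (m.code A pt).Iso (m'.code A pt)) :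
    m.SamePlateaus m' ∨ m.flip.SamePlateaus m' := by
  obtain ⟨σ, hle, hsame⟩ := iso_code_iff.1 h
  have hpairs : ∀ a b, (a, b) ∈ m.codePairs A pt ↔ (σ a, σ b) ∈ m'.codePairs A pt := fun a b => by
    have hx : ∀ (m : Profile) (a b : ℕ),
        (a, b) ∈ m.codePairs A pt ↔ m.CodeLE A pt a b ∧ ¬ m.CodeLE A pt b a := fun m a b => by
      simp only [codePairs, CodeLE, mem_ofPred_eq, ← not_le]
      have := le_total (pt a) (pt b)
      tauto
    rw [hx, hx, hle, hle]
  have hd : ∀ m : Profile, ∀ x ∈ m.codePairs A pt,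
      ¬(m.left (pt x.1) = m.left (pt x.2) ∧ m.right (pt x.1) = m.right (pt x.2)) :=
    fun m x hx hc => hx.2.2.ne (eq_of_left_eq_of_right_eq hc.1 hc.2)
  have := forall_iff_or_forall_iff_swap (hd m)
    (L' := fun x => m'.left (pt (σ x.1)) = m'.left (pt (σ x.2)))
    (R' := fun x => m'.right (pt (σ x.1)) = m'.right (pt (σ x.2)))
    (fun x hx => hd m' (σ x.1, σ x.2) ((hpairs _ _).1 hx))
    (fun x hx y hy => by
      have := hsame x.1 x.2 y.1 y.2
      simpa only [CodeSame, ← hpairs, show (x.1, x.2) ∈ m.codePairs A pt from hx,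
        show (y.1, y.2) ∈ m.codePairs A pt from hy, true_and] using this)
  refine this.imp (samePlateaus_of_equiv hA σ hle) fun h => ?_
  refine samePlateaus_of_equiv hA σ (by simpa only [CodeLE, live_flip] using hle) ?_
  simp only [codePairs, live_flip, left_flip_eq_iff, right_flip_eq_iff]
  exact fun x hx => (h x hx).symm

theorem iso_code_iff_samePlateaus (hinj : InjOn pt A) (hA : Dense (pt '' A)) (hAc : Aᶜ.Infinite) :
    (m.code A pt).Iso (m'.code A pt) ↔ m.SamePlateaus m' ∨ m.flip.SamePlateaus m' := by
  refine ⟨samePlateaus_or_of_iso hA, ?_⟩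
  rintro (h | h)
  · exact h.iso_code hinj hA hAc
  · have := h.iso_code hinj hA hAc
    rwa [code_flip] at this

/-! ### The coding map is Borel -/

theorem continuous_left_apply (u : unitInterval) : Continuous fun m : Profile => m.left u :=
  (((continuous_apply u).sub continuous_const).div_const 2).subtype_mk _

theorem continuous_right_apply (u : unitInterval) : Continuous fun m : Profile => m.right u :=
  (((continuous_apply u).add continuous_const).div_const 2).subtype_mk _

/-- Lying in a cell is expressed by quantifiers over a dense set, which makes it a Borel condition
when this set is countable. -/
theorem mem_cell_self_iff {D : Set unitInterval} (hD : Dense D) {u : unitInterval} :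
    u ∈ m.cell u ↔ ∃ p ∈ D, ∃ q ∈ D, p < u ∧ u < q ∧ (m.left p = m.left q ∨
      m.right p = m.right q ∨ ∀ a ∈ D, ∀ b ∈ D, p ≤ a → a < b → b ≤ q →
        m.left a ≠ m.left b ∧ m.right a ≠ m.right b) := by
  constructor
  · rintro ⟨p, q, h1, h2, _, _, h⟩
    obtain ⟨p', hp', h3, h4⟩ := hD.exists_between h1
    obtain ⟨q', hq', h5, h6⟩ := hD.exists_between h2
    refine ⟨p', hp', q', hq', h4, h5, (h.mono h3.le (h4.trans h5).le h6.le).imp_right ?_⟩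
    exact fun h => h.imp_right fun h a _ b _ => h a b
  · rintro ⟨p, hp, q, hq, h1, h2, h⟩
    refine ⟨p, q, h1, h2, h1, h2, h.imp_right fun h => h.imp_right fun h a b h3 h4 h5 => ?_⟩
    obtain ⟨c, hc, d, hd, h6, h7, h8⟩ := hD.exists_mem_between₂ h4
    have := h c hc d hd (h3.trans h6.le) h7 (h8.le.trans h5)
    constructor <;> intro he
    · exact this.1 (left_eq_of_le he h6.le (h7.trans h8).le (h6.trans h7).le h8.le)
    · exact this.2 (right_eq_of_le he h6.le (h7.trans h8).le (h6.trans h7).le h8.le)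

open Classical in
theorem measurable_code (hA : Dense (pt '' A)) :
    @Measurable Profile (ModSpace plateauLanguage) (borel _) (borel _) (code A pt) := by
  let _ : MeasurableSpace Profile := borel Profile
  have _ : BorelSpace Profile := ⟨rfl⟩
  have hl : ∀ u v, MeasurableSet {m : Profile | m.left u = m.left v} := fun u v =>
    (isClosed_eq (continuous_left_apply u) (continuous_left_apply v)).measurableSet
  have hr : ∀ u v, MeasurableSet {m : Profile | m.right u = m.right v} := fun u v =>
    (isClosed_eq (continuous_right_apply u) (continuous_right_apply v)).measurableSet
  have hDc : (pt '' A).Countable := A.to_countable.image pt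
  have hlive : ∀ n, MeasurableSet {m : Profile | n ∈ m.live A pt} := by
    intro n
    simp only [live, mem_ofPred_eq, mem_cell_self_iff hA]
    refine (MeasurableSet.const _).inter ?_
    have hex : ∀ {P : unitInterval → Profile → Prop}, (∀ p, MeasurableSet {m | P p m}) →
        MeasurableSet {m | ∃ p ∈ pt '' A, P p m} := fun {P} hP => by
      have : {m | ∃ p ∈ pt '' A, P p m} = ⋃ p ∈ pt '' A, {m | P p m} := by
        ext; simp only [mem_ofPred_eq, mem_iUnion, exists_prop]
      rw [this]
      exact MeasurableSet.biUnion hDc fun p _ => hP p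
    have hall : ∀ {P : unitInterval → Profile → Prop}, (∀ p, MeasurableSet {m | P p m}) →
        MeasurableSet {m | ∀ p ∈ pt '' A, P p m} := fun {P} hP => by
      have : {m | ∀ p ∈ pt '' A, P p m} = ⋂ p ∈ pt '' A, {m | P p m} := by
        ext; simp only [mem_ofPred_eq, mem_iInter]
      rw [this]
      exact MeasurableSet.biInter hDc fun p _ => hP p
    have himp : ∀ {c : Prop} {P : Profile → Prop}, MeasurableSet {m | P m} →
        MeasurableSet {m | c → P m} := fun {c P} hP => by
      by_cases hc : c
      · simpa only [hc, true_imp_iff] using hP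
      · simp only [hc, false_imp_iff]; exact MeasurableSet.univ
    refine hex fun p => hex fun q => (MeasurableSet.const _).inter ((MeasurableSet.const _).inter
      ((hl p q).union ((hr p q).union ?_)))
    exact hall fun a => hall fun b => himp (himp (himp ((hl a b).compl.inter (hr a b).compl)))
  have hpairs : ∀ x, MeasurableSet {m : Profile | x ∈ m.codePairs A pt} := fun x =>
    (hlive x.1).inter ((hlive x.2).inter (MeasurableSet.const _))
  have hbool : ∀ {P : Profile → Prop} [∀ m, Decidable (P m)], MeasurableSet {m | P m} →
      Measurable fun m => decide (P m) := fun {P} _ hP => by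
    refine measurable_to_bool ?_
    convert hP using 1
    ext
    simp
  have hR : Countable (Σ n : ℕ, plateauLanguage.Relations n) := countable_plateauLanguage
  have : @Measurable Profile (ModSpace plateauLanguage) (borel _) MeasurableSpace.pi
      (code A pt) := by
    refine measurable_pi_lambda _ fun R => measurable_pi_lambda _ fun v => ?_
    rcases R with ⟨_, (_ | _)⟩
    · exact hbool (P := fun m => m.CodeLE A pt (v 0) (v 1))
        ((hlive _).inter ((hlive _).inter (MeasurableSet.const _)))
    · exact hbool (P := fun m => m.CodeSame A pt (v 0, v 1) (v 2, v 3))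
        ((hpairs _).inter ((hpairs _).inter
        (((hl _ _).inter (hl _ _)).union ((hr _ _).inter (hr _ _)))))
  have hborel : (MeasurableSpace.pi : MeasurableSpace (ModSpace plateauLanguage)) = borel _ :=
    BorelSpace.measurable_eq
  rwa [hborel] at this

end Profile

/-! ### The circle as a quotient of the unit interval -/

/-- The map `x ↦ exp (2πix)` from the unit interval onto the circle, which identifies `0` and `1`
and is injective otherwise. -/
def wrap (x : unitInterval) : Circle := Circle.exp (2 * Real.pi * x)

theorem continuous_wrap : Continuous wrap :=
  Circle.exp.continuous.comp (by fun_prop)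

theorem wrap_zero : wrap 0 = 1 := by
  simp [wrap]

theorem wrap_one : wrap 1 = 1 := by
  simp [wrap]

theorem wrap_symm (x : unitInterval) : wrap (unitInterval.symm x) = (wrap x)⁻¹ := by
  rw [wrap, wrap, unitInterval.coe_symm_eq, ← Circle.exp_neg, mul_sub, mul_one, sub_eq_add_neg,
    add_comm, Circle.exp_add_two_pi]

theorem injOn_wrap_Ioc : InjOn wrap (Ioc 0 1) := by
  intro x hx y hy h
  have hpi : 0 < 2 * Real.pi := by positivity
  have key : ∀ {x : unitInterval}, x ∈ Ioc (0 : unitInterval) 1 →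
      2 * Real.pi * x ∈ Ioc (0 : ℝ) (2 * Real.pi) := fun {x} hx => by
    have h0 : (0 : ℝ) < x := hx.1
    have h1 : (x : ℝ) ≤ 1 := hx.2
    exact ⟨by positivity, by nlinarith⟩
  have := Circle.exp_injOn_Ioc (a := 0) (b := 2 * Real.pi) (by simp) (key hx) (key hy) h
  exact Subtype.ext (mul_left_cancel₀ hpi.ne' this)

theorem eq_of_wrap_eq {x y : unitInterval} (h : wrap x = wrap y) (h0 : 0 < y) (h1 : y < 1) :
    x = y := by
  rcases x.2.1.eq_or_lt with hx | hx
  · -- `wrap 0 = wrap 1`, and `wrap` is injective on `(0, 1]`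
    have hx : x = 0 := Subtype.ext hx.symm
    rw [hx, wrap_zero, ← wrap_one] at h
    exact absurd (injOn_wrap_Ioc ⟨zero_lt_one, le_rfl⟩ ⟨h0, h1.le⟩ h) h1.ne'
  · exact injOn_wrap_Ioc ⟨hx, x.2.2⟩ ⟨h0, h1.le⟩ h

theorem eq_zero_or_one_or_mem_Ioo (x : unitInterval) : x = 0 ∨ x = 1 ∨ (0 < x ∧ x < 1) := by
  rcases x.2.1.eq_or_lt with h | h
  · exact Or.inl (Subtype.ext h.symm)
  rcases x.2.2.eq_or_lt with h' | h'
  · exact Or.inr (Or.inl (Subtype.ext h'))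
  · exact Or.inr (Or.inr ⟨h, h'⟩)

theorem wrap_ne_one {x : unitInterval} (h0 : 0 < x) (h1 : x < 1) : wrap x ≠ 1 := fun h => by
  rw [← wrap_zero] at h
  exact h0.ne (eq_of_wrap_eq h.symm h0 h1)

theorem wrap_eq_wrap {x y : unitInterval} (h : wrap x = wrap y) :
    x = y ∨ (x = 0 ∨ x = 1) ∧ (y = 0 ∨ y = 1) := by
  rcases eq_zero_or_one_or_mem_Ioo y with hy | hy | hy
  · rcases eq_zero_or_one_or_mem_Ioo x with hx | hx | hx
    · exact Or.inr ⟨Or.inl hx, Or.inl hy⟩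
    · exact Or.inr ⟨Or.inr hx, Or.inl hy⟩
    · exact Or.inl (eq_of_wrap_eq h.symm hx.1 hx.2).symm
  · rcases eq_zero_or_one_or_mem_Ioo x with hx | hx | hx
    · exact Or.inr ⟨Or.inl hx, Or.inr hy⟩
    · exact Or.inr ⟨Or.inr hx, Or.inr hy⟩
    · exact Or.inl (eq_of_wrap_eq h.symm hx.1 hx.2).symm
  · exact Or.inl (eq_of_wrap_eq h hy.1 hy.2)

theorem exists_wrap_eq (z : Circle) : ∃ x ∈ Ioc (0 : unitInterval) 1, wrap x = z := by
  have hpi := Real.pi_pos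
  have h1 := Complex.neg_pi_lt_arg (z : ℂ)
  have h2 := Complex.arg_le_pi (z : ℂ)
  by_cases h : 0 < Complex.arg z
  · have e0 : 0 < Complex.arg z / (2 * Real.pi) := by positivity
    have e1 : Complex.arg z / (2 * Real.pi) ≤ 1 := by
      rw [div_le_one (by positivity)]; linarith
    refine ⟨⟨Complex.arg z / (2 * Real.pi), e0.le, e1⟩, ⟨e0, e1⟩, ?_⟩
    rw [wrap, mul_div_cancel₀ _ (by positivity), Circle.exp_arg]
  · have e0 : 0 < Complex.arg z / (2 * Real.pi) + 1 := by
      rw [← neg_lt_iff_pos_add, lt_div_iff₀ (by positivity)]; linarith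
    have e1 : Complex.arg z / (2 * Real.pi) + 1 ≤ 1 := by
      have : Complex.arg z / (2 * Real.pi) ≤ 0 :=
        div_nonpos_of_nonpos_of_nonneg (not_lt.1 h) (by positivity)
      linarith
    refine ⟨⟨Complex.arg z / (2 * Real.pi) + 1, e0.le, e1⟩, ⟨e0, e1⟩, ?_⟩
    rw [wrap, mul_add, mul_one, Circle.exp_add_two_pi, mul_div_cancel₀ _ (by positivity),
      Circle.exp_arg]

theorem wrap_surjective : Function.Surjective wrap := fun z =>
  let ⟨x, _, h⟩ := exists_wrap_eq z
  ⟨x, h⟩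

theorem isClosedMap_wrap : IsClosedMap wrap := continuous_wrap.isClosedMap

theorem isQuotientMap_wrap : IsQuotientMap wrap :=
  isClosedMap_wrap.isQuotientMap continuous_wrap wrap_surjective

theorem isOpen_wrap_image {V : Set unitInterval} (hV : IsOpen V) (h : V ⊆ Ioo 0 1) :
    IsOpen (wrap '' V) := by
  rw [← isQuotientMap_wrap.isOpen_preimage]
  have : wrap ⁻¹' (wrap '' V) = V := by
    refine Subset.antisymm ?_ (subset_preimage_image _ _)
    rintro x ⟨y, hy, hxy⟩
    rwa [eq_of_wrap_eq hxy.symm (h hy).1 (h hy).2]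
  rwa [this]

/-! ### Homeomorphisms of the circle and of the unit interval -/

/-- A homeomorphism of the unit interval is monotone or antitone, so it permutes the end points. -/
theorem Homeomorph.map_zero_or_one (g : unitInterval ≃ₜ unitInterval) {x : unitInterval}
    (hx : x = 0 ∨ x = 1) : g x = 0 ∨ g x = 1 := by
  have key : ∀ y : unitInterval, (∀ z, z ≤ y) ∨ (∀ z, y ≤ z) → y = 0 ∨ y = 1 := fun y hy =>
    hy.symm.imp (fun h => le_antisymm (h 0) y.2.1) fun h => le_antisymm y.2.2 (h 1)
  have hx' : (∀ z, x ≤ z) ∨ (∀ z, z ≤ x) := by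
    rcases hx with rfl | rfl
    · exact Or.inl fun z => z.2.1
    · exact Or.inr fun z => z.2.2
  apply key
  rcases g.continuous.strictMono_of_inj_boundedOrder' g.injective with h | h
  · exact hx'.symm.imp (fun hx z => g.apply_symm_apply z ▸ h.monotone (hx _))
      (fun hx z => g.apply_symm_apply z ▸ h.monotone (hx _))
  · exact hx'.imp (fun hx z => g.apply_symm_apply z ▸ h.antitone (hx _))
      (fun hx z => g.apply_symm_apply z ▸ h.antitone (hx _))

/-- Every homeomorphism of the unit interval descends to the circle. -/
theorem exists_homeomorph_wrap_eq (g : unitInterval ≃ₜ unitInterval) :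
    ∃ h : Circle ≃ₜ Circle, ∀ x, h (wrap x) = wrap (g x) := by
  let s : Circle → unitInterval := Function.surjInv wrap_surjective
  have hs : ∀ z, wrap (s z) = z := Function.surjInv_eq wrap_surjective
  have key : ∀ (g : unitInterval ≃ₜ unitInterval) (x : unitInterval),
      wrap (g (s (wrap x))) = wrap (g x) := fun g x => by
    rcases wrap_eq_wrap (hs (wrap x)) with h | ⟨h1, h2⟩
    · rw [h]
    · have : ∀ {x : unitInterval}, (x = 0 ∨ x = 1) → wrap x = 1 := by
        rintro x (rfl | rfl)
        exacts [wrap_zero, wrap_one]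
      rw [this (g.map_zero_or_one h1), this (g.map_zero_or_one h2)]
  have hc : ∀ g : unitInterval ≃ₜ unitInterval, Continuous fun z => wrap (g (s z)) := fun g => by
    rw [isQuotientMap_wrap.continuous_iff]
    have : (fun z => wrap (g (s z))) ∘ wrap = wrap ∘ g := funext (key g)
    rw [this]
    exact continuous_wrap.comp g.continuous
  have hinv : ∀ (g : unitInterval ≃ₜ unitInterval) (z : Circle),
      wrap (g.symm (s (wrap (g (s z))))) = z := fun g z => by
    rw [key g.symm, g.symm_apply_apply, hs]
  exact ⟨⟨⟨fun z => wrap (g (s z)), fun z => wrap (g.symm (s z)), hinv g, hinv g.symm⟩,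
    hc g, hc g.symm⟩, key g⟩

theorem exists_orderIso_of_strictMonoOn_Ioo {f : unitInterval → unitInterval}
    (hf : StrictMonoOn f (Ioo 0 1)) (himg : f '' Ioo 0 1 = Ioo 0 1) :
    ∃ G : unitInterval ≃o unitInterval, EqOn G f (Ioo 0 1) := by
  have h01 : (0 : unitInterval) < 1 := zero_lt_one
  have hd : Dense (Ioo (0 : unitInterval) 1) := by
    rw [dense_iff_closure_eq, closure_Ioo h01.ne]
    exact Icc_bot_top
  exact exists_orderIso_extending hd hd hf himg

/-- Every homeomorphism of the circle fixing `1` lifts to the unit interval: over the complement of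
`1` it is a continuous bijection of `(0, 1)`, which is strictly monotone or antitone. -/
theorem exists_homeomorph_lift (h : Circle ≃ₜ Circle) (h1 : h 1 = 1) :
    ∃ G : unitInterval ≃ₜ unitInterval, ∀ x, wrap (G x) = h (wrap x) := by
  let s : Circle → unitInterval := Function.surjInv wrap_surjective
  have hs : ∀ z, wrap (s z) = z := Function.surjInv_eq wrap_surjective
  have hIoo : ∀ x : unitInterval, x ∈ Ioo (0 : unitInterval) 1 ↔ wrap x ≠ 1 := fun x => by
    refine ⟨fun h => wrap_ne_one h.1 h.2, fun h => ?_⟩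
    rcases eq_zero_or_one_or_mem_Ioo x with rfl | rfl | hx
    · exact absurd wrap_zero h
    · exact absurd wrap_one h
    · exact hx
  let g : unitInterval → unitInterval := fun x => s (h (wrap x))
  have hg : ∀ x, wrap (g x) = h (wrap x) := fun x => hs _
  have hgIoo : ∀ {x}, x ∈ Ioo (0 : unitInterval) 1 → g x ∈ Ioo (0 : unitInterval) 1 :=
    fun {x} hx => by
      rw [hIoo] at hx ⊢
      rw [hg]
      exact fun hc => hx (h.injective (hc.trans h1.symm))
  have himg : g '' Ioo 0 1 = Ioo 0 1 := by
    refine Subset.antisymm (image_subset_iff.2 fun x hx => hgIoo hx) fun y hy => ?_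
    have hy' : s (h.symm (wrap y)) ∈ Ioo (0 : unitInterval) 1 := by
      rw [hIoo, hs]
      intro hc
      refine (hIoo y).1 hy ?_
      rw [← h.apply_symm_apply (wrap y), hc, h1]
    refine ⟨_, hy', eq_of_wrap_eq ?_ hy.1 hy.2⟩
    rw [hg, hs, h.apply_symm_apply]
  have hinj : InjOn g (Ioo 0 1) := fun x hx y hy hxy => by
    have := congrArg wrap hxy
    rw [hg, hg] at this
    exact eq_of_wrap_eq (h.injective this) hy.1 hy.2
  have hcont : ContinuousOn g (Ioo 0 1) := by
    rw [continuousOn_open_iff isOpen_Ioo]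
    intro V hV
    have : Ioo 0 1 ∩ g ⁻¹' V = Ioo 0 1 ∩ (h ∘ wrap) ⁻¹' (wrap '' (V ∩ Ioo 0 1)) := by
      ext x
      refine and_congr_right fun hx => ⟨fun hV => ⟨g x, ⟨hV, hgIoo hx⟩, hg x⟩, ?_⟩
      rintro ⟨y, ⟨hyV, hy⟩, he⟩
      have : g x = y := eq_of_wrap_eq ((hg x).trans he.symm) hy.1 hy.2
      change g x ∈ V
      rwa [this]
    rw [this]
    exact isOpen_Ioo.inter ((isOpen_wrap_image (hV.inter isOpen_Ioo) inter_subset_right).preimage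
      (h.continuous.comp continuous_wrap))
  obtain ⟨G, hG⟩ : ∃ G : unitInterval ≃ₜ unitInterval, EqOn G g (Ioo 0 1) := by
    rcases hcont.strictMonoOn_of_injOn_Ioo zero_lt_one hinj with hm | hm
    · obtain ⟨G, hG⟩ := exists_orderIso_of_strictMonoOn_Ioo hm himg
      exact ⟨G.toHomeomorph, hG⟩
    · obtain ⟨G, hG⟩ := exists_orderIso_of_strictMonoOn_Ioo (f := unitInterval.symm ∘ g)
        (fun x hx y hy hxy => unitInterval.symm_lt_symm.2 (hm hx hy hxy)) (by
          rw [image_comp, himg]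
          ext x
          constructor
          · rintro ⟨y, hy, rfl⟩
            exact ⟨unitInterval.symm_one ▸ unitInterval.symm_lt_symm.2 hy.2,
              unitInterval.symm_zero ▸ unitInterval.symm_lt_symm.2 hy.1⟩
          · intro hx
            exact ⟨unitInterval.symm x, ⟨unitInterval.symm_one ▸ unitInterval.symm_lt_symm.2 hx.2,
              unitInterval.symm_zero ▸ unitInterval.symm_lt_symm.2 hx.1⟩, unitInterval.symm_symm x⟩)
      refine ⟨G.toHomeomorph.trans unitInterval.symmHomeomorph, fun x hx => ?_⟩
      change unitInterval.symm (G x) = g x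
      rw [hG hx]
      exact unitInterval.symm_symm _
  -- both sides are continuous in `x` and agree on the dense set `(0, 1)`
  refine ⟨G, fun x => ?_⟩
  have hclosed : IsClosed {x | wrap (G x) = h (wrap x)} :=
    isClosed_eq (continuous_wrap.comp G.continuous) (h.continuous.comp continuous_wrap)
  have hsub : Icc (0 : unitInterval) 1 ⊆ {x | wrap (G x) = h (wrap x)} := by
    rw [← closure_Ioo (zero_lt_one (α := unitInterval)).ne]
    refine closure_minimal (fun x hx => ?_) hclosed
    change wrap (G x) = h (wrap x)
    rw [hG hx, hg]
  exact hsub ⟨x.2.1, x.2.2⟩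

/-! ### Chains on the circle -/

namespace Profile

variable {m m' : Profile}

/-- The image in the circle of the interval of length `u` of the chain with profile `m`. -/
def circleArc (m : Profile) (u : unitInterval) : Subcontinua Circle :=
  Subcontinua.map wrap continuous_wrap (m.arc u)

theorem coe_circleArc (m : Profile) (u : unitInterval) :
    ((m.circleArc u).1 : Set Circle) = wrap '' Icc (m.left u) (m.right u) := by
  rw [circleArc, Subcontinua.coe_map, coe_arc]

theorem left_pos_or_right_lt (m : Profile) {u : unitInterval} (hu : u < 1) :
    0 < m.left u ∨ m.right u < 1 := by
  by_contra! h
  have h0 : (m.left u : ℝ) ≤ 0 := h.1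
  have h1 : (1 : ℝ) ≤ m.right u := h.2
  have h2 : (u : ℝ) < 1 := hu
  linarith [m.right_sub_left u]

theorem injOn_wrap_arc (m : Profile) {u : unitInterval} (hu : u < 1) :
    InjOn wrap (Icc (m.left u) (m.right u)) := by
  intro x hx y hy h
  rcases wrap_eq_wrap h with h | ⟨rfl | rfl, rfl | rfl⟩
  · exact h
  · rfl
  · rcases m.left_pos_or_right_lt hu with h | h
    · exact absurd hx.1 h.not_ge
    · exact absurd hy.2 h.not_ge
  · rcases m.left_pos_or_right_lt hu with h | h
    · exact absurd hy.1 h.not_ge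
    · exact absurd hx.2 h.not_ge
  · rfl

theorem isChain_range_circleArc (m : Profile) : IsChain (· ≤ ·) (range m.circleArc) := by
  rintro _ ⟨u, rfl⟩ _ ⟨v, rfl⟩ _
  exact (le_total u v).imp (fun h => Subcontinua.map_mono _ _ (arc_le_arc_iff.2 h))
    fun h => Subcontinua.map_mono _ _ (arc_le_arc_iff.2 h)

theorem circleArc_one (m : Profile) : ((m.circleArc 1).1 : Set Circle) = univ := by
  rw [circleArc, Subcontinua.coe_map, arc_one, image_univ, wrap_surjective.range_eq]

theorem isMaxChain_range_circleArc (m : Profile) : IsMaxChain (· ≤ ·) (range m.circleArc) := by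
  refine isMaxChain_of_forall_comparable m.isChain_range_circleArc fun K hK => ?_
  by_cases hu : ∃ u < 1, K ≤ m.circleArc u
  · -- `K` lies in a proper arc, over which `wrap` is an embedding, so that `K` lifts
    obtain ⟨u, hu1, hu⟩ := hu
    rw [Subcontinua.le_iff, coe_circleArc] at hu
    have hinj := m.injOn_wrap_arc hu1
    let f : Icc (m.left u) (m.right u) → Circle := fun x => wrap x
    have hf : Continuous f := continuous_wrap.comp continuous_subtype_val
    have hrange : (K.1 : Set Circle) ⊆ range f := by
      intro z hz
      obtain ⟨x, hx, rfl⟩ := hu hz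
      exact ⟨⟨x, hx⟩, rfl⟩
    have hconn : IsConnected (Subtype.val '' (f ⁻¹' K.1) : Set unitInterval) :=
      (K.2.preimage_of_isClosedMap (injOn_iff_injective.1 hinj) hf.isClosedMap hrange).image _
        continuous_subtype_val.continuousOn
    have hcomp : IsCompact (Subtype.val '' (f ⁻¹' K.1) : Set unitInterval) :=
      ((K.1.isCompact.isClosed.preimage hf).isCompact).image continuous_subtype_val
    let J : Subcontinua unitInterval := ⟨⟨⟨_, hcomp⟩, hconn.nonempty⟩, hconn⟩
    have hJ : ∀ x, x ∈ (J.1 : Set unitInterval) ↔ x ∈ Icc (m.left u) (m.right u) ∧ wrap x ∈ K.1 :=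
      fun x => by
        constructor
        · rintro ⟨⟨x, hx⟩, hxK, rfl⟩
          exact ⟨hx, hxK⟩
        · rintro ⟨hx, hxK⟩
          exact ⟨⟨x, hx⟩, hxK, rfl⟩
    obtain ⟨v, hv⟩ : J ∈ range m.arc := by
      refine m.isMaxChain_range_arc.mem_of_forall_comparable ?_
      rintro _ ⟨v, rfl⟩
      rw [Subcontinua.le_iff, Subcontinua.le_iff, coe_arc]
      rcases le_total u v with huv | huv
      · exact Or.inl fun x hx => ⟨(m.left_anti huv).trans ((hJ x).1 hx).1.1,
          ((hJ x).1 hx).1.2.trans (m.right_mono huv)⟩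
      · have hsub : Icc (m.left v) (m.right v) ⊆ Icc (m.left u) (m.right u) :=
          Icc_subset_Icc (m.left_anti huv) (m.right_mono huv)
        rcases hK _ ⟨v, rfl⟩ with h | h <;> rw [Subcontinua.le_iff, coe_circleArc] at h
        · exact Or.inr fun x hx => (hJ x).2 ⟨hsub hx, h (mem_image_of_mem _ hx)⟩
        · refine Or.inl fun x hx => ?_
          obtain ⟨y, hy, hxy⟩ := h ((hJ x).1 hx).2
          rwa [← hinj (hsub hy) ((hJ x).1 hx).1 hxy]
    refine ⟨v, Subcontinua.ext_coe ?_⟩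
    rw [circleArc, hv, Subcontinua.coe_map]
    refine Subset.antisymm (image_subset_iff.2 fun x hx => ((hJ x).1 hx).2) fun z hz => ?_
    obtain ⟨x, hx, rfl⟩ := hu hz
    exact mem_image_of_mem _ ((hJ x).2 ⟨hx, hz⟩)
  · -- otherwise `K` contains all proper arcs of the chain, and these have dense union
    push Not at hu
    refine ⟨1, Subcontinua.ext_coe ?_⟩
    rw [circleArc_one, eq_comm, eq_univ_iff_forall]
    intro z
    obtain ⟨x, rfl⟩ := wrap_surjective z
    have hclosed : IsClosed (wrap ⁻¹' K.1) := K.1.isCompact.isClosed.preimage continuous_wrap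
    have hsub : Icc (0 : unitInterval) 1 ⊆ wrap ⁻¹' K.1 := by
      rw [← closure_Ioo (zero_lt_one (α := unitInterval)).ne]
      refine closure_minimal (fun x hx => ?_) hclosed
      obtain ⟨u, hu1, h1, h2⟩ := m.mem_arc_of_ne_one hx.1 hx.2
      have := (hK _ ⟨u, rfl⟩).resolve_right (hu u hu1)
      rw [Subcontinua.le_iff, coe_circleArc] at this
      exact this (mem_image_of_mem _ ⟨h1.le, h2.le⟩)
    exact hsub ⟨x.2.1, x.2.2⟩

/-- A nondegenerate subinterval of `[0,1]` is determined by its image in the circle. -/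
theorem _root_.subset_of_wrap_image_subset {J J' : Subcontinua unitInterval}
    (hJ : (J.1 : Set unitInterval).Nontrivial) (h : wrap '' J.1 ⊆ wrap '' J'.1) : J ≤ J' := by
  obtain ⟨a, b, hab, hJab⟩ := J.exists_eq_Icc
  rw [Subcontinua.le_iff]
  rw [hJab] at hJ h ⊢
  have hlt : a < b := hab.lt_of_ne fun hc => by
    rw [hc, Icc_self] at hJ
    exact not_nontrivial_singleton hJ
  rw [← closure_Ioo hlt.ne]
  refine closure_minimal (fun x hx => ?_) J'.1.isCompact.isClosed
  obtain ⟨y, hy, hyx⟩ := h (mem_image_of_mem _ (Ioo_subset_Icc_self hx))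
  rwa [← eq_of_wrap_eq hyx (a.2.1.trans_lt hx.1) (hx.2.trans_le b.2.2)]

theorem nontrivial_arc (m : Profile) {u : unitInterval} (hu : 0 < u) :
    ((m.arc u).1 : Set unitInterval).Nontrivial := by
  rw [coe_arc]
  refine ⟨m.left u, ⟨le_rfl, m.left_le_right u⟩, m.right u, ⟨m.left_le_right u, le_rfl⟩, ?_⟩
  intro h
  have h0 : (0 : ℝ) < u := hu
  rw [← m.right_sub_left u, h, sub_self] at h0
  exact lt_irrefl _ h0

theorem range_circleArc_injective (h : range m.circleArc = range m'.circleArc) : m = m' := by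
  have hclosed : IsClosed {u | m u = m' u} := isClosed_eq m.continuous_coe m'.continuous_coe
  have hsub : closure (Ioo (0 : unitInterval) 1) ⊆ {u | m u = m' u} := by
    refine closure_minimal (fun u hu => ?_) hclosed
    obtain ⟨v, hv⟩ : m.circleArc u ∈ range m'.circleArc := h ▸ mem_range_self u
    have himg : wrap '' (m'.arc v).1 = wrap '' (m.arc u).1 := by
      have := congrArg (fun K : Subcontinua Circle => (K.1 : Set Circle)) hv
      simpa only [circleArc, Subcontinua.coe_map] using this
    have h1 := subset_of_wrap_image_subset (m.nontrivial_arc hu.1) himg.ge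
    have h2 := subset_of_wrap_image_subset ((m.nontrivial_arc hu.1).mono h1) himg.le
    obtain ⟨rfl, h3⟩ := arc_eq_arc (le_antisymm h1 h2)
    exact h3
  rw [closure_Ioo (zero_lt_one (α := unitInterval)).ne] at hsub
  exact Profile.ext fun u => hsub ⟨u.2.1, u.2.2⟩

/-! ### The base point of a chain on the circle -/

/-- The base point is in the closure of the complement of each proper arc of the chain; this is the
property that characterizes it. -/
theorem one_mem_closure_compl_circleArc (m : Profile) {u : unitInterval} (hu : u < 1) :
    (1 : Circle) ∈ closure ((m.circleArc u).1 : Set Circle)ᶜ := by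
  have key : ∀ {a b : unitInterval}, a < b → (wrap a = 1 ∨ wrap b = 1) →
      (∀ x ∈ Ioo a b, x ∉ Icc (m.left u) (m.right u)) →
      (1 : Circle) ∈ closure ((m.circleArc u).1 : Set Circle)ᶜ := by
    intro a b hab hw hx
    have hsub : wrap '' Ioo a b ⊆ ((m.circleArc u).1 : Set Circle)ᶜ := by
      rintro _ ⟨x, hx', rfl⟩ hc
      rw [coe_circleArc] at hc
      obtain ⟨y, hy, hyx⟩ := hc
      rw [eq_of_wrap_eq hyx (a.2.1.trans_lt hx'.1) (hx'.2.trans_le b.2.2)] at hy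
      exact hx x hx' hy
    have h1 : wrap '' Icc a b ⊆ closure ((m.circleArc u).1 : Set Circle)ᶜ := by
      rw [← closure_Ioo hab.ne]
      exact (image_closure_subset_closure_image continuous_wrap).trans (closure_mono hsub)
    rcases hw with hw | hw
    · exact h1 ⟨a, ⟨le_rfl, hab.le⟩, hw⟩
    · exact h1 ⟨b, ⟨hab.le, le_rfl⟩, hw⟩
  rcases m.left_pos_or_right_lt hu with h | h
  · exact key h (Or.inl wrap_zero) fun x hx hx' => hx.2.not_ge hx'.1
  · exact key h (Or.inr wrap_one) fun x hx hx' => hx.1.not_ge hx'.2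

theorem eq_one_of_forall_mem_closure (m : Profile) {b : Circle}
    (h : ∀ u < 1, b ∈ closure ((m.circleArc u).1 : Set Circle)ᶜ) : b = 1 := by
  obtain ⟨x, rfl⟩ := wrap_surjective b
  rcases eq_zero_or_one_or_mem_Ioo x with rfl | rfl | ⟨h0, h1⟩
  · exact wrap_zero
  · exact wrap_one
  · exfalso
    obtain ⟨u, hu, h2, h3⟩ := m.mem_arc_of_ne_one h0 h1
    have hopen : IsOpen (wrap '' Ioo (m.left u) (m.right u)) :=
      isOpen_wrap_image isOpen_Ioo (Ioo_subset_Ioo (m.left u).2.1 (m.right u).2.2)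
    obtain ⟨z, hz, hz'⟩ := mem_closure_iff.1 (h u hu) _ hopen (mem_image_of_mem _ ⟨h2, h3⟩)
    refine hz' ?_
    rw [coe_circleArc]
    exact image_mono Ioo_subset_Icc_self hz

theorem circleArc_eq_univ_iff {u : unitInterval} :
    ((m.circleArc u).1 : Set Circle) = univ ↔ u = 1 := by
  constructor
  · intro h
    by_contra hc
    have hu : u < 1 := lt_of_le_of_ne u.2.2 hc
    have := m.one_mem_closure_compl_circleArc hu
    rw [h, compl_univ, closure_empty] at this
    exact this
  · rintro rfl
    exact m.circleArc_one

/-- A homeomorphism of the circle matching two chains with base point `1` fixes `1`. -/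
theorem map_one_of_image_eq {h : Circle ≃ₜ Circle}
    (heq : Subcontinua.map h h.continuous '' range m.circleArc = range m'.circleArc) :
    h 1 = 1 := by
  refine m'.eq_one_of_forall_mem_closure fun u hu => ?_
  obtain ⟨_, ⟨v, rfl⟩, hv⟩ : m'.circleArc u ∈ Subcontinua.map h h.continuous '' range m.circleArc :=
    heq ▸ mem_range_self u
  have hcoe : h '' (m.circleArc v).1 = (m'.circleArc u).1 := by
    rw [← hv, Subcontinua.coe_map]
  have hv1 : v < 1 := by
    refine lt_of_le_of_ne v.2.2 fun hc => hu.ne ?_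
    rw [← circleArc_eq_univ_iff (m := m'), ← hcoe, circleArc_eq_univ_iff.2 hc, image_univ,
      h.surjective.range_eq]
  rw [← hcoe, ← image_compl_eq h.bijective, ← h.image_closure]
  exact mem_image_of_mem _ (m.one_mem_closure_compl_circleArc hv1)

end Profile

/-! ### Lifting chains from the circle to the unit interval -/

/-- If points outside `K` approach the base point from the side of `0`, then the preimage of `K` in
`(0, 1]` is an interval. -/
theorem exists_lift_of_frequently {K : Subcontinua Circle}
    (h : ∀ ε : unitInterval, 0 < ε → ∃ t, 0 < t ∧ t < ε ∧ wrap t ∉ K.1) :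
    ∃ J, Subcontinua.map wrap continuous_wrap J = K := by
  let S : Set unitInterval := wrap ⁻¹' K.1 ∩ Ioc 0 1
  -- if `w` separates `x < y` in `S`, then `K` is separated by `w` and a point below `x`
  have hS : S.OrdConnected := by
    refine ⟨fun x hx y hy w hw => ⟨?_, hx.2.1.trans_le hw.1, w.2.2⟩⟩
    by_contra hwK
    have hxw : x < w := hw.1.lt_of_ne fun hc => hwK (hc ▸ hx.1)
    have hwy : w < y := hw.2.lt_of_ne fun hc => hwK (hc ▸ hy.1)
    obtain ⟨t, ht0, htx, htK⟩ := h x hx.2.1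
    have hw1 : w < 1 := hwy.trans_le y.2.2
    have ho : IsOpen (wrap '' Ioo t w) :=
      isOpen_wrap_image isOpen_Ioo (Ioo_subset_Ioo ht0.le hw1.le)
    have hc : IsClosed (wrap '' Icc t w) := isClosedMap_wrap _ isClosed_Icc
    have hdisj : Disjoint (wrap '' Ioo t w) (wrap '' Icc t w)ᶜ :=
      disjoint_compl_right_iff_subset.2 (image_mono Ioo_subset_Icc_self)
    have hcover : (K.1 : Set Circle) ⊆ wrap '' Ioo t w ∪ (wrap '' Icc t w)ᶜ := by
      intro z hz
      by_cases hzI : z ∈ wrap '' Icc t w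
      · obtain ⟨s, hs, rfl⟩ := hzI
        exact Or.inl ⟨s, ⟨hs.1.lt_of_ne fun hc => htK (hc ▸ hz),
          hs.2.lt_of_ne fun hc => hwK (hc ▸ hz)⟩, rfl⟩
      · exact Or.inr hzI
    rcases K.2.isPreconnected.subset_or_subset ho hc.isOpen_compl hdisj hcover with h' | h'
    · obtain ⟨s, hs, hsy⟩ := h' hy.1
      have := injOn_wrap_Ioc ⟨ht0.trans hs.1, s.2.2⟩ hy.2 hsy
      exact (hs.2.trans hwy).ne this
    · exact h' hx.1 ⟨x, ⟨htx.le, hxw.le⟩, rfl⟩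
  obtain ⟨z, hz⟩ := K.1.nonempty
  obtain ⟨x, hx, rfl⟩ := exists_wrap_eq z
  have hxS : x ∈ S := ⟨hz, hx⟩
  obtain ⟨t, ht0, htx, htK⟩ := h x hx.1
  have hSt : S = wrap ⁻¹' K.1 ∩ Icc t 1 := by
    ext y
    refine ⟨fun hy => ⟨hy.1, ?_, hy.2.2⟩, fun hy => ⟨hy.1, ht0.trans_le hy.2.1, hy.2.2⟩⟩
    by_contra! hc
    exact htK (hS.out hy hxS ⟨hc.le, htx.le⟩).1
  have hcomp : IsCompact S := by
    rw [hSt]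
    exact ((K.1.isCompact.isClosed.preimage continuous_wrap).inter isClosed_Icc).isCompact
  refine ⟨⟨⟨⟨S, hcomp⟩, ⟨x, hxS⟩⟩, ⟨⟨x, hxS⟩, hS.isPreconnected⟩⟩, Subcontinua.ext_coe ?_⟩
  rw [Subcontinua.coe_map]
  refine Subset.antisymm (image_subset_iff.2 fun y hy => hy.1) fun z hz => ?_
  obtain ⟨y, hy, rfl⟩ := exists_wrap_eq z
  exact mem_image_of_mem _ ⟨hz, hy⟩

/-- A subcontinuum of the circle whose complement accumulates at the base point is the image of a
subinterval of `[0,1]`. -/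
theorem exists_lift {K : Subcontinua Circle} (hK : (1 : Circle) ∈ closure (K.1 : Set Circle)ᶜ) :
    ∃ J, Subcontinua.map wrap continuous_wrap J = K := by
  by_cases h : ∀ ε : unitInterval, 0 < ε → ∃ t, 0 < t ∧ t < ε ∧ wrap t ∉ K.1
  · exact exists_lift_of_frequently h
  by_cases h' : ∀ ε : unitInterval, ε < 1 → ∃ t, ε < t ∧ t < 1 ∧ wrap t ∉ K.1
  · -- reflect the circle
    let K' : Subcontinua Circle := Subcontinua.map (fun z => z⁻¹) continuous_inv K
    have hK' : ∀ z, z ∈ K'.1 ↔ z⁻¹ ∈ K.1 := fun z => by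
      change z ∈ (K'.1 : Set Circle) ↔ _
      rw [Subcontinua.coe_map, image_inv_eq_inv]
      rfl
    obtain ⟨J, hJ⟩ := exists_lift_of_frequently (K := K') fun ε hε => by
      obtain ⟨t, h1, h2, h3⟩ := h' (unitInterval.symm ε)
        (unitInterval.symm_zero ▸ unitInterval.symm_lt_symm.2 hε)
      refine ⟨unitInterval.symm t, unitInterval.symm_one ▸ unitInterval.symm_lt_symm.2 h2, ?_, ?_⟩
      · have := unitInterval.symm_lt_symm.2 h1
        rwa [unitInterval.symm_symm] at this
      · rwa [hK', wrap_symm, inv_inv]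
    refine ⟨Subcontinua.map unitInterval.symm unitInterval.continuous_symm J,
      Subcontinua.ext_coe ?_⟩
    have hJ' : wrap '' J.1 = K'.1 := by rw [← hJ, Subcontinua.coe_map]
    rw [Subcontinua.coe_map, Subcontinua.coe_map, image_image]
    simp only [wrap_symm]
    rw [← image_image (fun z : Circle => z⁻¹) wrap, hJ']
    ext z
    rw [image_inv_eq_inv, mem_inv]
    change z⁻¹ ∈ K'.1 ↔ _
    rw [hK', inv_inv]
    rfl
  · -- otherwise `K` contains a neighbourhood of the base point
    exfalso
    push Not at h h'
    obtain ⟨ε, hε, h⟩ := h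
    obtain ⟨ε', hε', h'⟩ := h'
    have h1K : (1 : Circle) ∈ K.1 := by
      have hcl : IsClosed (wrap ⁻¹' K.1) := K.1.isCompact.isClosed.preimage continuous_wrap
      have : Icc 0 ε ⊆ wrap ⁻¹' K.1 := by
        rw [← closure_Ioo hε.ne]
        exact closure_minimal (fun t ht => h t ht.1 ht.2) hcl
      have := this ⟨le_rfl, hε.le⟩
      rwa [mem_preimage, wrap_zero] at this
    have hsub : (K.1 : Set Circle)ᶜ ⊆ wrap '' Icc ε ε' := by
      intro z hz
      obtain ⟨x, rfl⟩ := wrap_surjective z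
      rcases eq_zero_or_one_or_mem_Ioo x with rfl | rfl | hx
      · exact absurd (wrap_zero.symm ▸ h1K) hz
      · exact absurd (wrap_one.symm ▸ h1K) hz
      · exact ⟨x, ⟨not_lt.1 fun hc => hz (h x hx.1 hc), not_lt.1 fun hc => hz (h' x hc hx.2)⟩, rfl⟩
    obtain ⟨x, hx, hx1⟩ := closure_minimal hsub (isClosedMap_wrap _ isClosed_Icc) hK
    exact wrap_ne_one (hε.trans_le hx.1) (hx.2.trans_lt hε') hx1

/-- If the complements of all proper members of a maximal chain on the circle accumulate at the
base point, then the chain is the image of a chain on `[0,1]`: the nondegenerate lifts of its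
members, together with a point over its least member, form a chain, and extend to a maximal one. -/
theorem exists_range_circleArc_eq {S : Set (Subcontinua Circle)} (hS : IsMaxChain (· ≤ ·) S)
    (h1 : ∀ K ∈ S, (K.1 : Set Circle) ≠ univ → (1 : Circle) ∈ closure (K.1 : Set Circle)ᶜ) :
    ∃ m : Profile, range m.circleArc = S := by
  have hlift : ∀ K ∈ S, ∃ J, Subcontinua.map wrap continuous_wrap J = K := by
    intro K hK
    by_cases hu : (K.1 : Set Circle) = univ
    · refine ⟨Subcontinua.unit, Subcontinua.ext_coe ?_⟩
      rw [Subcontinua.coe_map, Subcontinua.coe_unit, image_univ, wrap_surjective.range_eq, hu]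
    · exact exists_lift (h1 K hK hu)
  let D₀ : Set (Subcontinua unitInterval) :=
    {J | (J.1 : Set unitInterval).Nontrivial ∧ Subcontinua.map wrap continuous_wrap J ∈ S}
  have hcomp : ∀ {J J' : Subcontinua unitInterval}, Subcontinua.map wrap continuous_wrap J ≤
      Subcontinua.map wrap continuous_wrap J' → wrap '' J.1 ⊆ wrap '' J'.1 := fun h => by
    rwa [Subcontinua.le_iff, Subcontinua.coe_map, Subcontinua.coe_map] at h
  have hD₀ : IsChain (· ≤ ·) D₀ := by
    intro J hJ J' hJ' _
    exact (hS.1.total hJ.2 hJ'.2).imp (fun h => subset_of_wrap_image_subset hJ.1 (hcomp h))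
      fun h => subset_of_wrap_image_subset hJ'.1 (hcomp h)
  suffices h : ∃ D₁ : Set (Subcontinua unitInterval), IsChain (· ≤ ·) D₁ ∧
      S ⊆ Subcontinua.map wrap continuous_wrap '' D₁ by
    obtain ⟨D₁, hD₁, hSD⟩ := h
    obtain ⟨D, hD, hDD⟩ := hD₁.exists_maxChain
    obtain ⟨m, rfl⟩ := Profile.exists_range_arc_eq hD
    refine ⟨m, (hS.2 m.isChain_range_circleArc fun K hK => ?_).symm⟩
    obtain ⟨J, hJ, rfl⟩ := hSD hK
    obtain ⟨u, rfl⟩ := hDD hJ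
    exact ⟨u, rfl⟩
  by_cases hsing : ∃ J, ¬(J.1 : Set unitInterval).Nontrivial ∧
      Subcontinua.map wrap continuous_wrap J ∈ S
  · obtain ⟨J₀, hJ₀, hJ₀S⟩ := hsing
    obtain ⟨y₀, hy₀⟩ := J₀.1.nonempty
    have hJ₀y : (J₀.1 : Set unitInterval) = {y₀} :=
      (not_nontrivial_iff.1 hJ₀).eq_singleton_of_mem hy₀
    have hmem : ∀ J ∈ D₀, wrap y₀ ∈ wrap '' J.1 := by
      intro J hJ
      rcases hS.1.total hJ₀S hJ.2 with h | h
      · exact hcomp h (mem_image_of_mem _ hy₀)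
      · exact absurd (hJ.1.mono (subset_of_wrap_image_subset hJ.1 (hcomp h))) hJ₀
    -- a point over the least member which lies in all nondegenerate lifts
    obtain ⟨y, hy, hyD⟩ : ∃ y, wrap y = wrap y₀ ∧ ∀ J ∈ D₀, y ∈ (J.1 : Set unitInterval) := by
      rcases eq_zero_or_one_or_mem_Ioo y₀ with h0 | h0 | h0
      rotate_left 2
      · refine ⟨y₀, rfl, fun J hJ => ?_⟩
        obtain ⟨y, hy, hyy⟩ := hmem J hJ
        rwa [← eq_of_wrap_eq hyy h0.1 h0.2]
      all_goals
        have hw : wrap y₀ = 1 := by rw [h0]; first | exact wrap_zero | exact wrap_one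
        have hor : ∀ J ∈ D₀, (0 : unitInterval) ∈ (J.1 : Set unitInterval) ∨
            (1 : unitInterval) ∈ (J.1 : Set unitInterval) := fun J hJ => by
          obtain ⟨y, hy, hyy⟩ := hmem J hJ
          rcases eq_zero_or_one_or_mem_Ioo y with rfl | rfl | h
          · exact Or.inl hy
          · exact Or.inr hy
          · exact absurd (hyy.trans hw) (wrap_ne_one h.1 h.2)
        by_contra! hc
        obtain ⟨J, hJ, hJ0⟩ := hc 0 (wrap_zero.trans hw.symm)
        obtain ⟨J', hJ', hJ1⟩ := hc 1 (wrap_one.trans hw.symm)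
        rcases hD₀.total hJ hJ' with h | h
        · exact hJ1 (h ((hor J hJ).resolve_left hJ0))
        · exact hJ0 (h ((hor J' hJ').resolve_right hJ1))
    let Y : Subcontinua unitInterval :=
      ⟨⟨⟨{y}, isCompact_singleton⟩, singleton_nonempty y⟩, isConnected_singleton⟩
    have hY : Subcontinua.map wrap continuous_wrap Y =
        Subcontinua.map wrap continuous_wrap J₀ := Subcontinua.ext_coe <| by
      rw [Subcontinua.coe_map, Subcontinua.coe_map, hJ₀y]
      change wrap '' {y} = _
      rw [image_singleton, image_singleton, hy]
    refine ⟨insert Y D₀, hD₀.insert fun J hJ _ => Or.inl ?_, fun K hK => ?_⟩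
    · exact singleton_subset_iff.2 (hyD J hJ)
    · obtain ⟨J, rfl⟩ := hlift K hK
      by_cases hJ : (J.1 : Set unitInterval).Nontrivial
      · exact ⟨J, Or.inr ⟨hJ, hK⟩, rfl⟩
      · refine ⟨Y, Or.inl rfl, hY.trans (Subcontinua.ext_coe ?_)⟩
        obtain ⟨w, hw⟩ := J.1.nonempty
        have hJw : (J.1 : Set unitInterval) = {w} :=
          (not_nontrivial_iff.1 hJ).eq_singleton_of_mem hw
        have htot := hS.1.total hJ₀S hK
        rw [Subcontinua.le_iff, Subcontinua.le_iff, Subcontinua.coe_map, Subcontinua.coe_map,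
          hJ₀y, hJw, image_singleton, image_singleton, singleton_subset_singleton,
          singleton_subset_singleton] at htot
        rw [Subcontinua.coe_map, Subcontinua.coe_map, hJ₀y, hJw, image_singleton, image_singleton,
          htot.elim id Eq.symm]
  · push Not at hsing
    refine ⟨D₀, hD₀, fun K hK => ?_⟩
    obtain ⟨J, rfl⟩ := hlift K hK
    exact ⟨J, ⟨by_contra fun hc => hsing J (not_nontrivial_iff.1 hc) hK, hK⟩, rfl⟩

/-- By compactness, the closures of the complements of the proper members of a chain have a common
point. -/
theorem exists_forall_mem_closure_compl {S : Set (Subcontinua Circle)}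
    (hS : IsChain (· ≤ ·) S) :
    ∃ b : Circle, ∀ K ∈ S, (K.1 : Set Circle) ≠ univ → b ∈ closure (K.1 : Set Circle)ᶜ := by
  let ι := {K : Subcontinua Circle // K ∈ S ∧ (K.1 : Set Circle) ≠ univ}
  rcases isEmpty_or_nonempty ι with h | h
  · exact ⟨1, fun K hK hu => (h.false ⟨K, hK, hu⟩).elim⟩
  · obtain ⟨b, hb⟩ := IsCompact.nonempty_iInter_of_directed_nonempty_isCompact_isClosed
      (fun K : ι => closure (K.1.1 : Set Circle)ᶜ)
      (fun K L => by
        rcases hS.total K.2.1 L.2.1 with h | h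
        · exact ⟨L, closure_mono (compl_subset_compl.2 h), Subset.rfl⟩
        · exact ⟨K, Subset.rfl, closure_mono (compl_subset_compl.2 h)⟩)
      (fun K => (nonempty_compl.2 K.2.2).closure)
      (fun K => isClosed_closure.isCompact) (fun K => isClosed_closure)
    exact ⟨b, fun K hK hu => mem_iInter.1 hb ⟨K, hK, hu⟩⟩

/-! ### The space of chains on the circle -/

namespace Profile

variable {m m' : Profile}

/-- The chain on the circle with base point `z` and profile `m`. -/
def circleChain (z : Circle) (m : Profile) : ChainSpace Circle :=
  ⟨Subcontinua.map (Subcontinua.map (fun x => z * wrap x) (continuous_const.mul continuous_wrap))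
    (Subcontinua.continuous_map _ _) m.subcontinuum, by
    rw [Subcontinua.coe_map, coe_subcontinuum]
    have : Subcontinua.map (fun x => z * wrap x) (continuous_const.mul continuous_wrap) ''
        range m.arc = Subcontinua.map (Homeomorph.mulLeft z) (Homeomorph.mulLeft z).continuous ''
          range m.circleArc := by
      rw [← range_comp, ← range_comp]
      congr 1
      funext u
      apply Subcontinua.ext_coe
      simp only [Function.comp, circleArc, Subcontinua.coe_map, image_image]
      rfl
    rw [this]
    exact Subcontinua.isMaxChain_image _ m.isMaxChain_range_circleArc⟩

theorem continuous_circleChain : Continuous fun p : Circle × Profile => p.2.circleChain p.1 := by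
  refine Continuous.subtype_mk ?_ _
  refine Subcontinua.continuous_map_family
    (g := fun (p : Circle × Profile) (K : Subcontinua unitInterval) =>
      Subcontinua.map (fun x => p.1 * wrap x) (continuous_const.mul continuous_wrap) K)
    (continuous_subcontinuum.comp continuous_snd) ?_
  refine Subcontinua.continuous_map_family
    (g := fun (q : (Circle × Profile) × Subcontinua unitInterval) (x : unitInterval) =>
      q.1.1 * wrap x) continuous_snd ?_
  exact (continuous_fst.comp (continuous_fst.comp continuous_fst)).mul
    (continuous_wrap.comp continuous_snd)

theorem range_circleArc (m : Profile) :
    range m.circleArc = Subcontinua.map wrap continuous_wrap '' range m.arc :=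
  range_comp _ _

theorem coe_circleChain_one (m : Profile) :
    ((m.circleChain 1).1.1 : Set (Subcontinua Circle)) = range m.circleArc := by
  refine (Subcontinua.coe_map _ _ _).trans ?_
  rw [coe_subcontinuum, ← range_comp]
  congr 1
  funext u
  apply Subcontinua.ext_coe
  simp only [Function.comp, circleArc, Subcontinua.coe_map, one_mul]

theorem _root_.ChainSpace.ext_coe {X : Type u} [TopologicalSpace X] {𝒞 𝒞' : ChainSpace X}
    (h : (𝒞.1.1 : Set (Subcontinua X)) = 𝒞'.1.1) : 𝒞 = 𝒞' :=
  Subtype.ext (Subcontinua.ext_coe h)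

theorem mulLeft_smul_circleChain (z : Circle) (m : Profile) :
    Homeomorph.mulLeft z • m.circleChain 1 = m.circleChain z := by
  apply ChainSpace.ext_coe
  rw [ChainSpace.coe_smul, coe_circleChain_one]
  refine Eq.trans ?_ (Subcontinua.coe_map _ _ _).symm
  rw [coe_subcontinuum, ← range_comp, ← range_comp]
  congr 1
  funext u
  apply Subcontinua.ext_coe
  simp only [Function.comp, circleArc, Subcontinua.coe_map, image_image]
  rfl

theorem circleChain_injective :
    Function.Injective fun p : Circle × Profile => p.2.circleChain p.1 := by
  rintro ⟨z, m⟩ ⟨z', m'⟩ h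
  simp only at h
  rw [← mulLeft_smul_circleChain, ← mulLeft_smul_circleChain z', ← inv_smul_eq_iff, smul_smul] at h
  have h1 : (((Homeomorph.mulLeft z')⁻¹ * Homeomorph.mulLeft z : Circle ≃ₜ Circle)) 1 = 1 := by
    refine map_one_of_image_eq (m := m) (m' := m') ?_
    rw [← coe_circleChain_one, ← coe_circleChain_one, ← h, ChainSpace.coe_smul]
  have hz : z = z' := by
    have h2 := congrArg (Homeomorph.mulLeft z') h1
    rw [← Homeomorph.mul_apply, mul_inv_cancel_left] at h2
    simpa using h2
  subst hz
  rw [inv_mul_cancel, one_smul] at h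
  have := congrArg (fun 𝒞 : ChainSpace Circle => (𝒞.1.1 : Set (Subcontinua Circle))) h
  simp only [coe_circleChain_one] at this
  rw [range_circleArc_injective this]

theorem circleChain_surjective :
    Function.Surjective fun p : Circle × Profile => p.2.circleChain p.1 := by
  intro 𝒞
  obtain ⟨b, hb⟩ := exists_forall_mem_closure_compl 𝒞.2.1
  -- rotate the base point to `1`
  have hS := ((Homeomorph.mulLeft b)⁻¹ • 𝒞).2
  rw [ChainSpace.coe_smul] at hS
  obtain ⟨m, hm⟩ := exists_range_circleArc_eq hS (by
    rintro _ ⟨K, hK, rfl⟩ hu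
    rw [Subcontinua.coe_map] at hu ⊢
    rw [← image_compl_eq (Homeomorph.bijective _), ← Homeomorph.image_closure]
    refine ⟨b, hb K hK fun hc => hu ?_, ?_⟩
    · rw [hc, image_univ, (Homeomorph.surjective _).range_eq]
    · change b⁻¹ * b = 1
      exact inv_mul_cancel b)
  refine ⟨(b, m), ?_⟩
  change m.circleChain b = 𝒞
  rw [← mulLeft_smul_circleChain, ← eq_inv_smul_iff]
  apply ChainSpace.ext_coe
  rw [coe_circleChain_one, ChainSpace.coe_smul, hm]

/-- The space of chains on the circle is the product of the circle and the space of profiles. -/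
def circleChainHomeomorph : Circle × Profile ≃ₜ ChainSpace Circle :=
  haveI : T2Space (ChainSpace Circle) := inferInstanceAs (T2Space {_𝒞 // _})
  Continuous.homeoOfEquivCompactToT2
    (f := Equiv.ofBijective _ ⟨circleChain_injective, circleChain_surjective⟩)
    continuous_circleChain

/-- Two chains on the circle are in the same orbit iff the chains on `[0,1]` with the same profiles
are: a homeomorphism matching the chains matches their base points, so that after rotations it
lifts to `[0,1]`. -/
theorem orbitRel_circleChain_iff {z z' : Circle} :
    ChainSpace.orbitRel Circle (m.circleChain z) (m'.circleChain z') ↔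
      ChainSpace.orbitRel unitInterval m.intervalChain m'.intervalChain := by
  constructor
  · rintro ⟨h, hh⟩
    change h • m'.circleChain z' = m.circleChain z at hh
    rw [← mulLeft_smul_circleChain, ← mulLeft_smul_circleChain z, ← inv_smul_eq_iff, smul_smul,
      smul_smul] at hh
    generalize (Homeomorph.mulLeft z)⁻¹ * h * Homeomorph.mulLeft z' = f at hh
    have himg : Subcontinua.map f f.continuous '' range m'.circleArc = range m.circleArc := by
      rw [← coe_circleChain_one, ← coe_circleChain_one, ← hh, ChainSpace.coe_smul]
    obtain ⟨G, hG⟩ := exists_homeomorph_lift f (map_one_of_image_eq himg)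
    refine ⟨G, ?_⟩
    change G • m'.intervalChain = m.intervalChain
    obtain ⟨m'', hm''⟩ := exists_intervalChain_eq (G • m'.intervalChain)
    have : range m''.circleArc = range m.circleArc := by
      rw [← himg]
      have h1 := congrArg
        (fun 𝒞 : ChainSpace unitInterval => (𝒞.1.1 : Set (Subcontinua unitInterval))) hm''
      simp only [coe_intervalChain, ChainSpace.coe_smul] at h1
      rw [range_circleArc, h1, range_circleArc, image_image, image_image]
      refine image_congr fun K _ => Subcontinua.ext_coe ?_
      simp only [Subcontinua.coe_map, image_image, hG]
    rw [← hm'', range_circleArc_injective this]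
  · rintro ⟨G, hG⟩
    change G • m'.intervalChain = m.intervalChain at hG
    obtain ⟨f, hf⟩ := exists_homeomorph_wrap_eq G
    refine ⟨Homeomorph.mulLeft z * f * (Homeomorph.mulLeft z')⁻¹, ?_⟩
    change (Homeomorph.mulLeft z * f * (Homeomorph.mulLeft z')⁻¹) • m'.circleChain z' =
      m.circleChain z
    rw [← mulLeft_smul_circleChain, ← mulLeft_smul_circleChain z, mul_smul, inv_smul_smul, mul_smul]
    congr 1
    apply ChainSpace.ext_coe
    have h1 := congrArg
      (fun 𝒞 : ChainSpace unitInterval => (𝒞.1.1 : Set (Subcontinua unitInterval))) hG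
    simp only [coe_intervalChain, ChainSpace.coe_smul] at h1
    rw [ChainSpace.coe_smul, coe_circleChain_one, coe_circleChain_one, range_circleArc,
      range_circleArc, ← h1, image_image, image_image]
    refine image_congr fun K _ => Subcontinua.ext_coe ?_
    simp only [Subcontinua.coe_map, image_image, hf]

/-! ### Chains without plateaus are generic -/

/-- The constant profile, whose chain consists of the intervals with midpoint `1 / 2`. -/
def const : Profile := ⟨fun _ => 1, LipschitzWith.of_dist_le_mul fun u v => by
  rw [dist_self]; positivity, rfl⟩

/-- The convex combination of a profile and the constant profile. -/
def mix (m : Profile) (t : unitInterval) : Profile :=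
  ⟨fun u => (1 - t) * m u + t, LipschitzWith.of_dist_le_mul fun u v => by
    have h := m.2.1.dist_le_mul u v
    rw [Real.dist_eq] at h ⊢
    refine le_trans ?_ h
    rw [show (1 - (t : ℝ)) * m u + t - ((1 - t) * m v + t) = (1 - t) * (m u - m v) by ring, abs_mul,
      abs_of_nonneg (by linarith [t.2.2])]
    exact mul_le_of_le_one_left (abs_nonneg _) (by linarith [t.2.1]), by
    change (1 - (t : ℝ)) * m 1 + t = 1
    rw [m.2.2]; ring⟩

theorem mix_apply (m : Profile) (t u : unitInterval) : m.mix t u = (1 - t) * m u + t := rfl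

theorem mix_zero (m : Profile) : m.mix 0 = m := Profile.ext fun u => by
  rw [mix_apply, Icc.coe_zero]; ring

theorem continuous_mix (m : Profile) : Continuous m.mix := by
  refine Continuous.subtype_mk (continuous_pi fun u => ?_) _
  fun_prop

theorem mix_ne {t p q : unitInterval} (ht : 0 < t) (hpq : p < q) :
    (m.mix t).left p ≠ (m.mix t).left q ∧ (m.mix t).right p ≠ (m.mix t).right q := by
  have ht : (0 : ℝ) < t := ht
  have ht1 : (0 : ℝ) ≤ 1 - t := by linarith [t.2.2]
  have hpq' : (p : ℝ) < q := hpq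
  have h1 := mul_le_mul_of_nonneg_left (m.sub_le hpq.le) ht1
  have h2 := mul_le_mul_of_nonneg_left (m.sub_le' hpq.le) ht1
  have h3 : 0 < t * ((q : ℝ) - p) := mul_pos ht (by linarith)
  constructor <;> intro h <;> have h := congrArg Subtype.val h
  · rw [coe_left, coe_left, mix_apply, mix_apply] at h
    nlinarith
  · rw [coe_right, coe_right, mix_apply, mix_apply] at h
    nlinarith

/-- The profiles for which neither end point takes the same value at `p` and `q`. -/
def moving (p q : unitInterval) : Set Profile :=
  {m | m.left p ≠ m.left q ∧ m.right p ≠ m.right q}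

theorem isOpen_moving (p q : unitInterval) : IsOpen (moving p q) :=
  (isOpen_ne_fun (continuous_left_apply p) (continuous_left_apply q)).inter
    (isOpen_ne_fun (continuous_right_apply p) (continuous_right_apply q))

theorem dense_moving {p q : unitInterval} (hpq : p < q) : Dense (moving p q) := by
  intro m
  have h0 : (0 : unitInterval) ∈ closure (Ioo 0 1) := by
    rw [closure_Ioo (zero_lt_one (α := unitInterval)).ne]
    exact ⟨le_rfl, zero_le_one⟩
  have := image_closure_subset_closure_image m.continuous_mix (mem_image_of_mem _ h0)
  rw [mix_zero] at this
  refine closure_mono ?_ this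
  rintro _ ⟨t, ht, rfl⟩
  exact mix_ne ht.1 hpq

/-- By density, a profile whose end points are distinct at all pairs from a dense set has no
nondegenerate plateau, as is the case for the constant profile. -/
theorem const_samePlateaus {D : Set unitInterval} (hD : Dense D)
    (h : ∀ p ∈ D, ∀ q ∈ D, p < q → m ∈ moving p q) : m.SamePlateaus const := by
  have hne : ∀ {u v : unitInterval}, u < v → m.left u ≠ m.left v ∧ m.right u ≠ m.right v := by
    intro u v huv
    obtain ⟨p, hp, q, hq, h1, h2, h3⟩ := hD.exists_mem_between₂ huv
    have := h p hp q hq h2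
    refine ⟨fun he => this.1 ?_, fun he => this.2 ?_⟩
    · exact left_eq_of_le he h1.le (h2.trans h3).le (h1.trans h2).le h3.le
    · exact right_eq_of_le he h1.le (h2.trans h3).le (h1.trans h2).le h3.le
  have hc : ∀ {u v : unitInterval},
      (const.left u = const.left v ↔ u = v) ∧ (const.right u = const.right v ↔ u = v) := by
    intro u v
    refine ⟨⟨fun h => ?_, fun h => h ▸ rfl⟩, ⟨fun h => ?_, fun h => h ▸ rfl⟩⟩ <;>
      have h := congrArg Subtype.val h <;> apply Subtype.ext
    · have h : ((1 : ℝ) - u) / 2 = (1 - v) / 2 := h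
      linarith
    · have h : ((1 : ℝ) + u) / 2 = (1 + v) / 2 := h
      linarith
  refine ⟨OrderIso.refl _, fun u v => ?_⟩
  simp only [OrderIso.refl_apply, hc]
  rcases lt_trichotomy u v with huv | rfl | huv
  · simp only [(hne huv).1, (hne huv).2, huv.ne, iff_self, and_self]
  · simp only [and_self]
  · simp only [(hne huv).1.symm, (hne huv).2.symm, huv.ne', iff_self, and_self]

theorem isGeneric_circleChain_const : (const.circleChain 1).IsGeneric := by
  obtain ⟨D, hDc, hD⟩ := exists_countable_dense unitInterval
  let s : Set (ChainSpace Circle) := ⋂ p ∈ D, ⋂ q ∈ D, ⋂ _ : p < q,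
    (fun 𝒞 => (circleChainHomeomorph.symm 𝒞).2) ⁻¹' moving p q
  have hs : s ∈ residual (ChainSpace Circle) := by
    refine (countable_bInter_mem hDc).2 fun p _ => (countable_bInter_mem hDc).2 fun q _ =>
      countable_iInter_mem.2 fun hpq => ?_
    refine residual_of_dense_open ((isOpen_moving p q).preimage
      (continuous_snd.comp circleChainHomeomorph.symm.continuous)) ?_
    exact (dense_moving hpq).preimage (isOpenMap_snd.comp circleChainHomeomorph.symm.isOpenMap)
  refine Filter.mem_of_superset hs fun 𝒞 h𝒞 => ?_
  obtain ⟨⟨z, m⟩, rfl⟩ := circleChainHomeomorph.surjective 𝒞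
  simp only [s, mem_iInter, mem_preimage, Homeomorph.symm_apply_apply] at h𝒞
  change ChainSpace.orbitRel Circle (m.circleChain z) (const.circleChain 1)
  rw [orbitRel_circleChain_iff, orbitRel_intervalChain_iff]
  exact Or.inl (const_samePlateaus hD fun p hp q hq hpq => h𝒞 p hp q hq hpq)

end Profile

/-- An enumeration of a dense set of lengths, with infinitely many indices left over. -/
theorem exists_dense_image_of_infinite_compl : ∃ (A : Set ℕ) (pt : ℕ → unitInterval),
    InjOn pt A ∧ Dense (pt '' A) ∧ Aᶜ.Infinite := by
  obtain ⟨D, hDc, hD⟩ := exists_countable_dense unitInterval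
  have : Countable D := hDc.to_subtype
  have : Infinite unitInterval := (Icc_infinite (zero_lt_one' ℝ)).to_subtype
  have : Infinite D := Set.Infinite.to_subtype fun hf =>
    infinite_univ ((hf.isClosed.closure_eq.symm.trans hD.closure_eq) ▸ hf)
  obtain ⟨e⟩ : Nonempty (ℕ ≃ D) := nonempty_equiv_of_countable
  have hA : (fun n : ℕ => (e (n / 2) : unitInterval)) '' range (fun n => 2 * n) = D := by
    rw [← range_comp]
    ext x
    constructor
    · rintro ⟨n, rfl⟩
      exact (e _).2
    · intro hx
      exact ⟨e.symm ⟨x, hx⟩, by simp⟩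
  refine ⟨range fun n => 2 * n, fun n => e (n / 2), ?_, hA.symm ▸ hD, ?_⟩
  · rintro _ ⟨a, rfl⟩ _ ⟨b, rfl⟩ h
    have := e.injective (Subtype.ext h)
    simp only at this ⊢
    omega
  · refine infinite_of_injective_forall_mem (f := fun n : ℕ => 2 * n + 1) (fun a b h => ?_) ?_
    · simp only at h
      omega
    · rintro n ⟨k, hk⟩
      simp only at hk
      omega

theorem classifiable_orbitRel_circle :
    ClassifiableByCountableStructures (ChainSpace.orbitRel Circle) := by
  obtain ⟨A, pt, hinj, hA, hAc⟩ := exists_dense_image_of_infinite_compl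
  refine ⟨plateauLanguage, inferInstance, countable_plateauLanguage,
    fun 𝒞 => (Profile.circleChainHomeomorph.symm 𝒞).2.code A pt, ?_, fun 𝒞 𝒞' => ?_⟩
  · exact @Measurable.comp _ _ _ (borel _) (borel _) (borel _) _ _ (Profile.measurable_code hA)
      (continuous_snd.comp Profile.circleChainHomeomorph.symm.continuous).borel_measurable
  · obtain ⟨⟨z, m⟩, rfl⟩ := Profile.circleChainHomeomorph.surjective 𝒞
    obtain ⟨⟨z', m'⟩, rfl⟩ := Profile.circleChainHomeomorph.surjective 𝒞'
    simp only [Homeomorph.symm_apply_apply]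
    rw [Profile.iso_code_iff_samePlateaus hinj hA hAc, ← Profile.orbitRel_intervalChain_iff]
    exact Profile.orbitRel_circleChain_iff

theorem continuouslyReducible_orbitRel_circle :
    ContinuouslyReducible (ChainSpace.orbitRel Circle) (ChainSpace.orbitRel unitInterval) := by
  refine ⟨fun 𝒞 => (Profile.circleChainHomeomorph.symm 𝒞).2.intervalChain,
    Profile.continuous_intervalChain.comp
      (continuous_snd.comp Profile.circleChainHomeomorph.symm.continuous), fun 𝒞 𝒞' => ?_⟩
  obtain ⟨⟨z, m⟩, rfl⟩ := Profile.circleChainHomeomorph.surjective 𝒞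
  obtain ⟨⟨z', m'⟩, rfl⟩ := Profile.circleChainHomeomorph.surjective 𝒞'
  simp only [Homeomorph.symm_apply_apply]
  exact Profile.orbitRel_circleChain_iff

end

theorem theoremA6 :
    ContinuouslyReducible (ChainSpace.orbitRel Circle) (ChainSpace.orbitRel unitInterval) ∧
      ClassifiableByCountableStructures (ChainSpace.orbitRel Circle) ∧
      ∃ 𝒞 : ChainSpace Circle, 𝒞.IsGeneric :=
  ⟨continuouslyReducible_orbitRel_circle, classifiable_orbitRel_circle, _,
    Profile.isGeneric_circleChain_const⟩
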